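/- Let $n\ge 2$. Let $t\in\mathbb R$, $x=(x_1,\dots,x_n)\in\mathbb R^n$ be the independent variables and $\psi$ a complex dependent variable. Subscripts denote partial derivatives, with $\partial_\psi,\partial_{\psi^*}$ the Wirtinger derivatives; subscripts $a,b,c$ of functions refer to $x_a,x_b,x_c$; $a,b,c$ run from $1$ to $n$, and summation over repeated indices is understood; $\nabla\psi=(\psi_1,\dots,\psi_n)$, and $^*$ is complex conjugation. The class $\mathscr N$ consists of the equations $$\mathcal L_{GF}:\quad i\psi_t+G\,\psi_{aa}+F=0,$$ where $G$ and $F$ are smooth complex-valued functions of $(t,x,\psi,\psi^*,\nabla\psi,\nabla\psi^*)$ and $G$ vanishes nowhere. Let $U\subseteq\mathbb R\times\mathbb R^n\times\mathbb C$ be an open set of values of $(t,x,\psi)$ whose fibres over the points $(t,x)$ are connected, and let $$\varphi:\quad \tilde t=T(t,x,\psi,\psi^*),\quad \tilde x_a=X^a(t,x,\psi,\psi^*),\quad \tilde\psi=\Psi(t,x,\psi,\psi^*),\quad \tilde\psi^*=\Psi^*(t,x,\psi,\psi^*)$$ be a smooth point transformation on $U$, with $T,X^a$ real-valued, $\Psi$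 complex-valued and $\mathrm dT\wedge\mathrm dX^1\wedge\dots\wedge\mathrm dX^n\wedge\mathrm d\Psi\wedge\mathrm d\Psi^*\ne0$ on $U$. Let $\mathcal L_{GF}$ and $\mathcal L_{\tilde G\tilde F}$ be equations of the class $\mathscr N$, with $(t,x,\psi)$ ranging over $U$ and over $\varphi(U)$, respectively, and with arbitrary values of $\nabla\psi$. The triple $((G,F),\varphi,(\tilde G,\tilde F))$ belongs to the equivalence groupoid $\mathcal G^\sim_{\mathscr N}$ if $\varphi$ maps $\mathcal L_{GF}$ to $\mathcal L_{\tilde G\tilde F}$, i.e., if a second-order jet over $U$ at which the prolongation of $\varphi$ is defined satisfies $\mathcal L_{GF}$ if and only if its image under this prolongation satisfies $\mathcal L_{\tilde G\tilde F}$. **Theorem.** The triple $((G,F),\varphi,(\tilde G,\tilde F))$ belongs to $\mathcal G^\sim_{\mathscr N}$ if and only if there is a positive smooth real-valued function $H$ of $(t,x)$ (on the projection of $U$) such that the following holds. 1. On $U$, $$T_\psi=T_{\psi^*}=0,\quad T_a=0,\quad T_t\ne0,\quad X^a_\psi=X^a_{\psi^*}=0,\quad X^b_aX^c_a=H\delta_{bc}.$$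 2. At every point $(t,x,\psi,\nabla\psi)$ over $U$: if $G^*\ne-G$, then $\Psi_\psi\Psi_{\psi^*}=0$. 3. At every point $(t,x,\psi,\nabla\psi)$ over $U$, with $\tilde G$ and $\tilde F$ evaluated at the transformed point $\tilde t=T$, $\tilde x_b=X^b$, $\tilde\psi=\Psi$, $\tilde\psi_{\tilde x_b}=H^{-1}X^b_a\mathrm D_a\Psi$, $$\tilde G=\frac H{T_t}G\ \text{ if }\ \Psi_\psi\ne0,\qquad \tilde G=\frac H{T_t}(-G^*)\ \text{ if }\ \Psi_{\psi^*}\ne0$$ (both equalities hold if both derivatives are nonzero), and $$\tilde F=\frac{\Psi_\psi}{T_t}F-\frac{\Psi_{\psi^*}}{T_t}F^*-\Bigl(\hat\Delta\Psi+\frac{n-2}2\,\frac{H_a}H\,\mathrm D_a\Psi\Bigr)\frac{\tilde G}H-\frac i{T_t}\Bigl(\Psi_t-X^b_t\frac{X^b_a}H\mathrm D_a\Psi\Bigr).$$ Here $\mathrm D_a\Psi=\Psi_a+\psi_a\Psi_\psi+\psi^*_a\Psi_{\psi^*}$ and $\hat\Delta=\partial_{aa}+2\psi_a\partial_{a\psi}+2\psi^*_a\partial_{a\psi^*}+\psi_a\psi_a\partial_{\psi\psi}+2\psi_a\psi^*_a\partial_{\psi\psi^*}+\psi^*_a\psi^*_a\partial_{\psi^*\psi^*}$.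 -/

import Mathlib

open scoped ContDiff ComplexConjugate

noncomputable section

/-- The space of the independent variables `(t, x)`. -/
abbrev Indep (n : ℕ) : Type := ℝ × (Fin n → ℝ)

/-- The space of the variables `(t, x, ψ)`. A function of `(t, x, ψ, ψ*)` is a function on this
space, smoothness is meant over `ℝ`, and derivatives in `ψ`, `ψ*` are Wirtinger derivatives. -/
abbrev Vars (n : ℕ) : Type := ℝ × (Fin n → ℝ) × ℂ

/-- The space of `(t, x, ψ, ∇ψ)`, with `∇ψ` the spatial gradient. -/
abbrev GradVars (n : ℕ) : Type := Vars n × (Fin n → ℂ)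

/-! Partial derivatives of functions of `(t, x)`. -/

section IndepDerivatives

variable {n : ℕ} {E : Type*} [NormedAddCommGroup E] [NormedSpace ℝ E]

/-- `u_t`. -/
def pdT (u : Indep n → E) (q : Indep n) : E := fderiv ℝ u q (1, 0)

/-- `u_a`, the derivative with respect to `x_a`. -/
def pdX (a : Fin n) (u : Indep n → E) (q : Indep n) : E := fderiv ℝ u q (0, Pi.single a 1)

end IndepDerivatives

/-! Partial derivatives of functions of `(t, x, ψ, ψ*)`. -/

section VarsDerivatives

variable {n : ℕ} {E : Type*} [NormedAddCommGroup E] [NormedSpace ℝ E]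

/-- `f_t`. -/
def vdT (f : Vars n → E) (z : Vars n) : E := fderiv ℝ f z (1, 0, 0)

/-- `f_a`, the derivative with respect to `x_a`. -/
def vdX (a : Fin n) (f : Vars n → E) (z : Vars n) : E := fderiv ℝ f z (0, Pi.single a 1, 0)

/-- `f_ψ`. -/
def vdPsi (f : Vars n → ℂ) (z : Vars n) : ℂ :=
  (fderiv ℝ f z (0, 0, 1) - Complex.I * fderiv ℝ f z (0, 0, Complex.I)) / 2

/-- `f_{ψ*}`. -/
def vdPsiBar (f : Vars n → ℂ) (z : Vars n) : ℂ :=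
  (fderiv ℝ f z (0, 0, 1) + Complex.I * fderiv ℝ f z (0, 0, Complex.I)) / 2

/-- The total derivative `D_a f = f_a + ψ_a f_ψ + ψ*_a f_{ψ*}` at `(t, x, ψ, ∇ψ) = (z, p)`. -/
def totalDX (a : Fin n) (f : Vars n → ℂ) (z : Vars n) (p : Fin n → ℂ) : ℂ :=
  vdX a f z + p a * vdPsi f z + conj (p a) * vdPsiBar f z

/-- The operator `∂_aa + 2 ψ_a ∂_{aψ} + 2 ψ*_a ∂_{aψ*} + ψ_a ψ_a ∂_{ψψ} + 2 ψ_a ψ*_a ∂_{ψψ*}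
+ ψ*_a ψ*_a ∂_{ψ*ψ*}` (summation over `a`) at `(t, x, ψ, ∇ψ) = (z, p)`. -/
def hatLaplacian (f : Vars n → ℂ) (z : Vars n) (p : Fin n → ℂ) : ℂ :=
  ∑ a, (vdX a (vdX a f) z
    + 2 * p a * vdX a (vdPsi f) z
    + 2 * conj (p a) * vdX a (vdPsiBar f) z
    + p a * p a * vdPsi (vdPsi f) z
    + 2 * p a * conj (p a) * vdPsi (vdPsiBar f) z
    + conj (p a) * conj (p a) * vdPsiBar (vdPsiBar f) z)

end VarsDerivatives

/-- An equation `i ψ_t + G ψ_aa + F = 0` of the class `𝒩` over a set `V` of values of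
`(t, x, ψ)`: `G` and `F` are smooth functions of `(t, x, ψ, ψ*, ∇ψ, ∇ψ*)` for `(t, x, ψ)` in `V`
and `G` does not vanish. -/
structure ClassN (n : ℕ) (V : Set (Vars n)) where
  G : GradVars n → ℂ
  F : GradVars n → ℂ
  smooth_G : ContDiffOn ℝ ∞ G (V ×ˢ Set.univ)
  smooth_F : ContDiffOn ℝ ∞ F (V ×ˢ Set.univ)
  G_ne_zero : ∀ z ∈ V, ∀ p, G (z, p) ≠ 0

/-- The point `(t, x, ψ, ∇ψ)` given by the function `ψ = u` at `q = (t, x)`. -/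
def gradJet {n : ℕ} (u : Indep n → ℂ) (q : Indep n) : GradVars n :=
  ((q.1, q.2, u q), fun a => pdX a u q)

/-- The second-order jet of `u` at the point `q` lies on the equation. -/
def ClassN.HoldsAt {n : ℕ} {V : Set (Vars n)} (L : ClassN n V) (u : Indep n → ℂ)
    (q : Indep n) : Prop :=
  Complex.I * pdT u q + L.G (gradJet u q) * ∑ a, pdX a (pdX a u) q + L.F (gradJet u q) = 0

/-- A point transformation `t̃ = T`, `x̃_a = X^a`, `ψ̃ = Ψ` of the space of `(t, x, ψ, ψ*)`,
with an open domain of definition and with nonvanishing Jacobian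
(equivalently, `dT ∧ dX^1 ∧ ⋯ ∧ dX^n ∧ dΨ ∧ dΨ* ≠ 0`). -/
structure PointTransformation (n : ℕ) where
  dom : Set (Vars n)
  isOpen_dom : IsOpen dom
  T : Vars n → ℝ
  X : Vars n → Fin n → ℝ
  Ψ : Vars n → ℂ
  smooth_T : ContDiffOn ℝ ∞ T dom
  smooth_X : ContDiffOn ℝ ∞ X dom
  smooth_Ψ : ContDiffOn ℝ ∞ Ψ dom
  nondegenerate : ∀ z ∈ dom, (fderiv ℝ (fun w => (T w, X w, Ψ w) : Vars n → Vars n) z).det ≠ 0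

namespace PointTransformation

variable {n : ℕ} (φ : PointTransformation n)

/-- The transformation as a map. -/
def toMap (z : Vars n) : Vars n := (φ.T z, φ.X z, φ.Ψ z)

/-- The image of the transformation. -/
def image : Set (Vars n) := φ.toMap '' φ.dom

/-- The new independent variables along the graph of `u`, as functions of the old ones. -/
def newIndep (u : Indep n → ℂ) (q : Indep n) : Indep n :=
  (φ.T (q.1, q.2, u q), φ.X (q.1, q.2, u q))

/-- The prolongation of `φ` to jets: near the point `q`, the transformation `φ` maps the graph
of `u` to the graph of the function `v` (near the image point), where the total Jacobian
`det (D_μ X^ν)`, `X^0 = T`, does not vanish at `q`. So the jets of `v` at `φ.newIndep u q` are the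
images of the jets of `u` at `q` under the standard prolongations of `φ`. -/
structure CarriesAt (u : Indep n → ℂ) (q : Indep n) (v : Indep n → ℂ) : Prop where
  mem_dom : (q.1, q.2, u q) ∈ φ.dom
  smooth_source : ContDiffAt ℝ ∞ u q
  smooth_target : ContDiffAt ℝ ∞ v (φ.newIndep u q)
  total_jacobian : (fderiv ℝ (φ.newIndep u) q).det ≠ 0
  eq_near : ∀ᶠ r in nhds q, v (φ.newIndep u r) = φ.Ψ (r.1, r.2, u r)

/-- `φ` maps the equation `L` to the equation `L'`, i.e. `(L, φ, L')` is an admissible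
transformation, an element of the equivalence groupoid of the class `𝒩`: the second-order
prolongation of `φ` maps the subset of the jet space defined by `L` (together with the
conjugate equation) to the one defined by `L'`, and so does its inverse in the opposite
direction. -/
def IsAdmissible (L : ClassN n φ.dom) (L' : ClassN n φ.image) : Prop :=
  ∀ (u : Indep n → ℂ) (q : Indep n) (v : Indep n → ℂ), φ.CarriesAt u q v →
    (L.HoldsAt u q ↔ L'.HoldsAt v (φ.newIndep u q))

/-- The projection of the domain to the space of `(t, x)`. -/
def indepDom : Set (Indep n) := (fun z : Vars n => (z.1, z.2.1)) '' φ.dom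

/-- The system `T_ψ = T_{ψ*} = 0`, `T_a = 0`, `T_t ≠ 0`, `X^a_ψ = X^a_{ψ*} = 0`,
`X^b_a X^c_a = H δ_bc` on the domain, with a positive smooth function `H` of `(t, x)`. -/
structure IsConformalWith (H : Indep n → ℝ) : Prop where
  smooth_H : ContDiffOn ℝ ∞ H φ.indepDom
  H_pos : ∀ q ∈ φ.indepDom, 0 < H q
  T_psi : ∀ z ∈ φ.dom, vdPsi (fun w => (φ.T w : ℂ)) z = 0
  T_psiBar : ∀ z ∈ φ.dom, vdPsiBar (fun w => (φ.T w : ℂ)) z = 0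
  T_x : ∀ z ∈ φ.dom, ∀ a, vdX a φ.T z = 0
  T_t : ∀ z ∈ φ.dom, vdT φ.T z ≠ 0
  X_psi : ∀ z ∈ φ.dom, ∀ a, vdPsi (fun w => (φ.X w a : ℂ)) z = 0
  X_psiBar : ∀ z ∈ φ.dom, ∀ a, vdPsiBar (fun w => (φ.X w a : ℂ)) z = 0
  conformal : ∀ z ∈ φ.dom, ∀ b c,
    ∑ a, vdX a (fun w => φ.X w b) z * vdX a (fun w => φ.X w c) z
      = if b = c then H (z.1, z.2.1) else 0

/-- For transformations with `T = T(t)`, `X = X(t, x)`, `X^b_a X^c_a = H δ_bc`, the transformed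
values of `(t, x, ψ, ∇ψ)`; the chain rule `D_a Ψ = ψ̃_b X^b_a` gives
`ψ̃_b = H⁻¹ X^b_a D_a Ψ`. -/
def newGradVars (H : Indep n → ℝ) (z : Vars n) (p : Fin n → ℂ) : GradVars n :=
  (φ.toMap z, fun b =>
    ∑ a, ((vdX a (fun w => φ.X w b) z / H (z.1, z.2.1) : ℝ) : ℂ) * totalDX a φ.Ψ z p)

/-- The expression of the transformed arbitrary element `F̃`, where `g` is the value of `G̃`. -/
def newF (H : Indep n → ℝ) (F : GradVars n → ℂ) (g : ℂ) (z : Vars n) (p : Fin n → ℂ) : ℂ :=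
  vdPsi φ.Ψ z / ((vdT φ.T z : ℝ) : ℂ) * F (z, p)
    - vdPsiBar φ.Ψ z / ((vdT φ.T z : ℝ) : ℂ) * conj (F (z, p))
    - (hatLaplacian φ.Ψ z p
        + ((n : ℂ) - 2) / 2 *
          ∑ a, ((pdX a H (z.1, z.2.1) / H (z.1, z.2.1) : ℝ) : ℂ) * totalDX a φ.Ψ z p)
      * (g / (H (z.1, z.2.1) : ℂ))
    - Complex.I / ((vdT φ.T z : ℝ) : ℂ) *
      (vdT φ.Ψ z - ∑ b, ∑ a, ((vdT (fun w => φ.X w b) z * vdX a (fun w => φ.X w b) z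
          / H (z.1, z.2.1) : ℝ) : ℂ) * totalDX a φ.Ψ z p)

end PointTransformation

end

/-! A pair of corresponding functions `u`, `v` satisfies `v ∘ Y = Ψ` along the graph of `u`, where
`Y = (T, X)`; differentiating twice gives the second-order prolongation of the transformation.

If two jets over the same first-order jet satisfy `L`, their Hessians differ by a form `B` whose
spatial trace vanishes, and admissibility forces the transformed trace of `B` to vanish as well.
Hence, at every first-order jet, `∑_a D_a Y ⊗ D_a Y` is a positive multiple of the standard form
`∑_a e_a ⊗ e_a` on the space of `x`, which has rank `n ≥ 2`. It depends quadratically on `∇ψ`, with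
second differences of rank at most one built from the derivative of `Y` along the `ψ`-fibre: so `Y`
does not depend on `ψ`, and the conformality conditions on `T` and `X` follow.

For such a transformation the left-hand side of `L'`, multiplied by `T_t`, becomes
`Ψ_ψ (i ψ_t + γ ψ_aa + F) - Ψ_{ψ*} (i ψ_t - γ* ψ_aa + F)* + T_t (F̃ - newF)` with `γ = T_t G̃ / H`.
It has to vanish exactly when `i ψ_t + G ψ_aa + F` does; eliminating `ψ_t` and comparing the
coefficients of `ψ_aa` and its conjugate gives the remaining conditions, which also suffice. -/

section SecondDerivatives

variable {𝕜 E F K : Type*} [NontriviallyNormedField 𝕜] [NormedAddCommGroup E] [NormedSpace 𝕜 E]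
  [NormedAddCommGroup F] [NormedSpace 𝕜 F] [NormedAddCommGroup K] [NormedSpace 𝕜 K]

theorem two_le_infty : (2 : WithTop ℕ∞) ≤ ∞ :=
  WithTop.coe_le_coe.2 le_top

theorem differentiableAt_fderiv_of_contDiffAt {f : E → F} {x : E} (hf : ContDiffAt 𝕜 2 f x) :
    DifferentiableAt 𝕜 (fderiv 𝕜 f) x :=
  (hf.fderiv_right (m := 1) (by norm_num [one_add_one_eq_two])).differentiableAt one_ne_zero

theorem eventually_differentiableAt_of_contDiffAt {f : E → F} {x : E} (hf : ContDiffAt 𝕜 1 f x) :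
    ∀ᶠ y in nhds x, DifferentiableAt 𝕜 f y :=
  (hf.eventually (by simp)).mono fun _ hy => hy.differentiableAt one_ne_zero

theorem hasFDerivAt_fderiv_apply {f : E → F} {x : E} (hf : ContDiffAt 𝕜 2 f x) (a : E) :
    HasFDerivAt (fun y => fderiv 𝕜 f y a) ((fderiv 𝕜 (fderiv 𝕜 f) x).flip a) x := by
  simpa using (differentiableAt_fderiv_of_contDiffAt hf).hasFDerivAt.clm_apply
    (hasFDerivAt_const a x)

theorem fderiv_fderiv_apply {f : E → F} {x : E} (hf : ContDiffAt 𝕜 2 f x) (a b : E) :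
    fderiv 𝕜 (fun y => fderiv 𝕜 f y a) x b = fderiv 𝕜 (fderiv 𝕜 f) x b a :=
  congrArg (· b) (hasFDerivAt_fderiv_apply hf a).fderiv

theorem fderiv_fderiv_comp {g : F → K} {f : E → F} {x : E} (hg : ContDiffAt 𝕜 2 g (f x))
    (hf : ContDiffAt 𝕜 2 f x) (a b : E) :
    fderiv 𝕜 (fderiv 𝕜 (fun y => g (f y))) x a b
      = fderiv 𝕜 (fderiv 𝕜 g) (f x) (fderiv 𝕜 f x a) (fderiv 𝕜 f x b)
        + fderiv 𝕜 g (f x) (fderiv 𝕜 (fderiv 𝕜 f) x a b) := by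
  have hev : fderiv 𝕜 (fun y => g (f y)) =ᶠ[nhds x]
      fun y => (fderiv 𝕜 g (f y)).comp (fderiv 𝕜 f y) := by
    filter_upwards [hf.continuousAt.eventually
        (eventually_differentiableAt_of_contDiffAt (hg.of_le one_le_two)),
      eventually_differentiableAt_of_contDiffAt (hf.of_le one_le_two)] with y hgy hfy
    exact fderiv_comp y hgy hfy
  have hDg : HasFDerivAt (fun y => fderiv 𝕜 g (f y))
      ((fderiv 𝕜 (fderiv 𝕜 g) (f x)).comp (fderiv 𝕜 f x)) x :=
    (differentiableAt_fderiv_of_contDiffAt hg).hasFDerivAt.comp x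
      (hf.differentiableAt two_ne_zero).hasFDerivAt
  have hDf := (differentiableAt_fderiv_of_contDiffAt hf).hasFDerivAt
  rw [hev.fderiv_eq, (hDg.clm_comp hDf).fderiv]
  simp [add_comm]

theorem fderiv_fderiv_clm_comp (A : F →L[𝕜] K) {f : E → F} {x : E} (hf : ContDiffAt 𝕜 2 f x)
    (a b : E) :
    fderiv 𝕜 (fderiv 𝕜 (fun y => A (f y))) x a b = A (fderiv 𝕜 (fderiv 𝕜 f) x a b) := by
  have hA : fderiv 𝕜 (A : F → K) = fun _ => A := funext fun y => A.fderiv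
  rw [fderiv_fderiv_comp A.contDiff.contDiffAt hf, hA]
  simp

end SecondDerivatives

section RealDerivatives

variable {E F : Type*} [NormedAddCommGroup E] [NormedSpace ℝ E] [NormedAddCommGroup F]
  [NormedSpace ℝ F]

theorem fderiv_fderiv_comm {f : E → F} {x : E} (hf : ContDiffAt ℝ 2 f x) (a b : E) :
    fderiv ℝ (fderiv ℝ f) x a b = fderiv ℝ (fderiv ℝ f) x b a :=
  hf.isSymmSndFDerivAt (by simp) a b

theorem exists_contDiff_of_jet (q : E) (w : F) (p : E →L[ℝ] F) {B : E →L[ℝ] E →L[ℝ] F}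
    (hB : ∀ a b, B a b = B b a) :
    ∃ u : E → F, ContDiff ℝ ω u ∧ u q = w ∧ fderiv ℝ u q = p ∧ fderiv ℝ (fderiv ℝ u) q = B := by
  let u : E → F := fun r => w + p (r - q) + (1 / 2 : ℝ) • B (r - q) (r - q)
  have hsub (r : E) : HasFDerivAt (fun r : E => r - q) (ContinuousLinearMap.id ℝ E) r :=
    (hasFDerivAt_id r).sub_const q
  have hu : fderiv ℝ u = fun r => p + B (r - q) := by
    funext r
    have hBr := (B.hasFDerivAt.comp r (hsub r)).clm_apply (hsub r)
    have hur : HasFDerivAt u _ r :=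
      ((p.hasFDerivAt.comp r (hsub r)).const_add w).add (hBr.const_smul (1 / 2 : ℝ))
    rw [hur.fderiv]
    ext a
    simp only [ContinuousLinearMap.comp_id, add_apply, smul_apply,
      ContinuousLinearMap.flip_apply, Function.comp_apply, hB a, ← two_smul ℝ, smul_smul]
    norm_num
  refine ⟨u, by fun_prop, by simp [u], by simp [hu], ?_⟩
  rw [hu]
  exact ((B.hasFDerivAt.comp q (hsub q)).const_add p).fderiv.trans B.comp_id

section Fibres

variable {P Q W : Type*} [NormedAddCommGroup P] [NormedSpace ℝ P] [NormedAddCommGroup Q]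
  [NormedSpace ℝ Q] [NormedAddCommGroup W] [NormedSpace ℝ W] {s : Set (P × Q × W)}

theorem eq_of_fderiv_fibre_eq_zero (hs : IsOpen s) {t : P} {x : Q}
    (hfib : IsPreconnected {w | (t, x, w) ∈ s}) {f : P × Q × W → E} (hf : DifferentiableOn ℝ f s)
    (hf' : ∀ z ∈ s, ∀ w, fderiv ℝ f z (0, 0, w) = 0) {w w' : W} (hw : (t, x, w) ∈ s)
    (hw' : (t, x, w') ∈ s) : f (t, x, w) = f (t, x, w') := by
  have hder (v : W) (hv : (t, x, v) ∈ s) :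
      HasFDerivAt (fun v => f (t, x, v)) (0 : W →L[ℝ] E) v := by
    have hincl : HasFDerivAt (fun v : W => (t, x, v))
        (ContinuousLinearMap.prod 0 (.prod 0 (.id ℝ W))) v :=
      (hasFDerivAt_const t v).prodMk ((hasFDerivAt_const x v).prodMk (hasFDerivAt_id v))
    have hfv := (hf.differentiableAt (hs.mem_nhds hv)).hasFDerivAt
    exact (hfv.comp v hincl).congr_fderiv (ContinuousLinearMap.ext fun y => hf' _ hv y)
  have hopen : IsOpen {v | (t, x, v) ∈ s} := hs.preimage (by fun_prop)
  exact hopen.is_const_of_fderiv_eq_zero hfib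
    (fun v hv => (hder v hv).differentiableAt.differentiableWithinAt)
    (fun v hv => (hder v hv).fderiv) hw hw'

theorem exists_contDiffOn_eq_of_fderiv_fibre_eq_zero (hs : IsOpen s)
    (hfib : ∀ t x, IsPreconnected {w | (t, x, w) ∈ s}) {m : WithTop ℕ∞} (hm : m ≠ 0)
    {f : P × Q × W → E} (hf : ContDiffOn ℝ m f s)
    (hf' : ∀ z ∈ s, ∀ w, fderiv ℝ f z (0, 0, w) = 0) :
    ∃ h : P × Q → E, ContDiffOn ℝ m h ((fun z => (z.1, z.2.1)) '' s) ∧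
      ∀ z ∈ s, f z = h (z.1, z.2.1) := by
  choose! σ hσ using fun q (hq : q ∈ (fun z : P × Q × W => (z.1, z.2.1)) '' s) => hq
  have hfσ : ∀ z ∈ s, f z = f (σ (z.1, z.2.1)) := by
    intro z hz
    obtain ⟨hmem, hproj⟩ := hσ _ ⟨z, hz, rfl⟩
    obtain ⟨ht, hx⟩ := Prod.mk.inj hproj
    have heq : σ (z.1, z.2.1) = (z.1, z.2.1, (σ (z.1, z.2.1)).2.2) := Prod.ext ht (Prod.ext hx rfl)
    rw [heq] at hmem ⊢
    exact eq_of_fderiv_fibre_eq_zero hs (hfib _ _) (hf.differentiableOn hm) hf' hz hmem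
  refine ⟨f ∘ σ, ?_, hfσ⟩
  rintro _ ⟨z, hz, rfl⟩
  have hsec : ContDiffAt ℝ m (fun r : P × Q => (r.1, r.2, z.2.2)) (z.1, z.2.1) := by fun_prop
  have hlift : ContDiffAt ℝ m (fun r : P × Q => f (r.1, r.2, z.2.2)) (z.1, z.2.1) :=
    (hf.contDiffAt (hs.mem_nhds hz)).comp (z.1, z.2.1) hsec
  refine (hlift.congr_of_eventuallyEq ?_).contDiffWithinAt
  filter_upwards [hsec.continuousAt.eventually (hs.mem_nhds hz)] with r hr
  exact (hfσ _ hr).symm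

end Fibres

end RealDerivatives

section LinearAlgebra

theorem exists_injective_add_comp_of_range_sup_range_eq_top {k V W : Type*} [DivisionRing k]
    [AddCommGroup V] [Module k V] [FiniteDimensional k V] [AddCommGroup W] [Module k W]
    (A : V →ₗ[k] V) (B : W →ₗ[k] V) (hAB : LinearMap.range A ⊔ LinearMap.range B = ⊤) :
    ∃ p : V →ₗ[k] W, Function.Injective (A + B ∘ₗ p) := by
  let π := (LinearMap.range A).mkQ
  have hπA (v : V) : π (A v) = 0 := by simp [π]
  have hsurj : Function.Surjective (π ∘ₗ B) := by
    intro y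
    obtain ⟨v, rfl⟩ := (LinearMap.range A).mkQ_surjective y
    have hv : v ∈ LinearMap.range A ⊔ LinearMap.range B := hAB ▸ Submodule.mem_top
    obtain ⟨_, ⟨a, rfl⟩, _, ⟨b, rfl⟩, rfl⟩ := Submodule.mem_sup.1 hv
    exact ⟨b, by simp [π]⟩
  obtain ⟨s, hs⟩ := (π ∘ₗ B).exists_rightInverse_of_surjective (LinearMap.range_eq_top.2 hsurj)
  have hdim : Module.finrank k (LinearMap.ker A)
      = Module.finrank k (V ⧸ LinearMap.range A) := by
    have hker := A.finrank_range_add_finrank_ker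
    have hquot := (LinearMap.range A).finrank_quotient_add_finrank
    omega
  let e : LinearMap.ker A ≃ₗ[k] (V ⧸ LinearMap.range A) := LinearEquiv.ofFinrankEq _ _ hdim
  obtain ⟨r, hr⟩ := (LinearMap.ker A).subtype.exists_leftInverse_of_injective (by simp)
  -- On `ker A` this lifts an isomorphism onto `coker A` through `B`.
  refine ⟨s ∘ₗ e.toLinearMap ∘ₗ r, ?_⟩
  rw [← LinearMap.ker_eq_bot, LinearMap.ker_eq_bot']
  intro v hv
  replace hv : A v + B (s (e (r v))) = 0 := hv
  have hrv : r v = 0 := by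
    have hπ := congrArg π hv
    rw [map_add, hπA, zero_add, map_zero] at hπ
    have : π (B (s (e (r v)))) = e (r v) := LinearMap.congr_fun hs _
    simpa [this] using hπ
  have hAv : A v = 0 := by simpa [hrv] using hv
  simpa [hrv] using (congrArg Subtype.val (LinearMap.congr_fun hr ⟨v, hAv⟩)).symm

theorem det_ne_zero_iff_injective {k V : Type*} [Field k] [TopologicalSpace V] [AddCommGroup V]
    [Module k V] [FiniteDimensional k V] [TopologicalSpace k] {A : V →L[k] V} :
    A.det ≠ 0 ↔ Function.Injective A := by
  rw [Ne, ContinuousLinearMap.det, LinearMap.det_eq_zero_iff_ker_ne_bot, not_not,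
    LinearMap.ker_eq_bot]
  rfl

theorem exists_sum_bilin_eq_mul_sum_bilin {ι κ k E : Type*} [Fintype ι] [Fintype κ]
    [NontriviallyNormedField k] [NormedAddCommGroup E] [NormedSpace k E] {e : ι → E} {e' : κ → E}
    (h : ∀ B : E →L[k] E →L[k] k, (∀ a b, B a b = B b a) →
      ∑ i, B (e i) (e i) = 0 → ∑ j, B (e' j) (e' j) = 0) :
    ∃ c : k, ∀ B : E →L[k] E →L[k] k, (∀ a b, B a b = B b a) →
      ∑ j, B (e' j) (e' j) = c * ∑ i, B (e i) (e i) := by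
  by_cases h₀ : ∃ B₀ : E →L[k] E →L[k] k, (∀ a b, B₀ a b = B₀ b a) ∧ ∑ i, B₀ (e i) (e i) ≠ 0
  · obtain ⟨B₀, hsymm, hB₀⟩ := h₀
    refine ⟨(∑ j, B₀ (e' j) (e' j)) / ∑ i, B₀ (e i) (e i), fun B hB => ?_⟩
    have hcomb := h (B - ((∑ i, B (e i) (e i)) / ∑ i, B₀ (e i) (e i)) • B₀)
      (fun a b => by simp [hB a b, hsymm a b])
      (by simp [Finset.sum_sub_distrib, ← Finset.mul_sum, hB₀])
    simp only [sub_apply, smul_apply, smul_eq_mul, Finset.sum_sub_distrib, ← Finset.mul_sum,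
      sub_eq_zero] at hcomb
    rw [hcomb]
    ring
  · push Not at h₀
    exact ⟨0, fun B hB => by rw [h B hB (h₀ B hB), zero_mul]⟩

theorem exists_pos_sum_mul_eq_mul_sum {ι E : Type*} [Fintype ι] [NormedAddCommGroup E]
    [NormedSpace ℝ E] (N : E ≃L[ℝ] E) {e : ι → E} {f₀ : E →L[ℝ] ℝ} {a₀ : ι} (h₀ : f₀ (e a₀) ≠ 0)
    (h : ∀ B : E →L[ℝ] E →L[ℝ] ℝ, (∀ a b, B a b = B b a) →
      ∑ a, B (e a) (e a) = 0 → ∑ a, B (N.symm (e a)) (N.symm (e a)) = 0) :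
    ∃ c : ℝ, 0 < c ∧ ∀ f g : E →L[ℝ] ℝ,
      ∑ a, f (N (e a)) * g (N (e a)) = c * ∑ a, f (e a) * g (e a) := by
  obtain ⟨c, hc⟩ := exists_sum_bilin_eq_mul_sum_bilin h
  have hprod (f g : E →L[ℝ] ℝ) :
      ∑ a, f (e a) * g (e a) = c * ∑ a, f (N (e a)) * g (N (e a)) := by
    let f' := f.comp (N : E →L[ℝ] E)
    let g' := g.comp (N : E →L[ℝ] E)
    have hpol := hc (f'.smulRight g' + g'.smulRight f') (fun a b => by simp; ring)
    simp only [add_apply, ContinuousLinearMap.smulRight_apply, smul_apply, smul_eq_mul, f', g',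
      ContinuousLinearMap.comp_apply, ContinuousLinearEquiv.coe_coe, N.apply_symm_apply,
      mul_comm (g _), ← two_mul, ← Finset.mul_sum] at hpol
    linarith
  have hpos : 0 < c * ∑ a, f₀ (N (e a)) * f₀ (N (e a)) := by
    rw [← hprod]
    exact Finset.sum_pos' (fun a _ => mul_self_nonneg _)
      ⟨a₀, Finset.mem_univ a₀, mul_self_pos.2 h₀⟩
  have hc₀ : 0 < c := pos_of_mul_pos_left hpos (Finset.sum_nonneg fun a _ => mul_self_nonneg _)
  exact ⟨c⁻¹, inv_pos.2 hc₀, fun f g => by rw [hprod, inv_mul_cancel_left₀ hc₀.ne']⟩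

/-- The left-hand side has rank at most one, the right-hand side has rank zero or at least two. -/
theorem eq_zero_of_forall_mul_eq_mul_sum {ι E : Type*} [Fintype ι] [DecidableEq ι] [Nontrivial ι]
    [NormedAddCommGroup E] [NormedSpace ℝ E] {e : ι → E} {d : ι → E →L[ℝ] ℝ}
    (hd : ∀ a b, d a (e b) = if a = b then 1 else 0) {ξ : E} {κ : ℝ}
    (h : ∀ f g : E →L[ℝ] ℝ, f ξ * g ξ = κ * ∑ a, f (e a) * g (e a)) : ξ = 0 := by
  obtain ⟨i, j, hij⟩ := exists_pair_ne ι
  have hκ : κ = 0 := by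
    have hi : d i ξ * d i ξ = κ := by simpa [hd] using h (d i) (d i)
    have hj : d j ξ * d j ξ = κ := by simpa [hd] using h (d j) (d j)
    have hmix : d i ξ * d j ξ = 0 := by simpa [hd, hij, hij.symm] using h (d i) (d j)
    have hκκ : κ * κ = (d i ξ * d j ξ) * (d i ξ * d j ξ) := by
      nth_rewrite 1 [← hi]
      rw [← hj]
      ring
    simpa [hmix] using hκκ
  refine SeparatingDual.eq_zero_of_forall_dual_eq_zero (R := ℝ) fun f => ?_
  simpa [hκ] using h f f

theorem sum_mul_eq_ite_of_sum_mul_eq_ite {ι k : Type*} [Fintype ι] [DecidableEq ι] [Field k]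
    {M : ι → ι → k} {c : k} (hc : c ≠ 0)
    (hM : ∀ i j, ∑ a, M i a * M j a = if i = j then c else 0) (a b : ι) :
    ∑ i, M i a * M i b = if a = b then c else 0 := by
  let A : Matrix ι ι k := Matrix.of M
  have hright : A * (c⁻¹ • A.transpose) = 1 := by
    ext i j
    rw [Matrix.mul_smul, Matrix.smul_apply, Matrix.mul_apply, Matrix.one_apply]
    simp only [Matrix.transpose_apply, A, Matrix.of_apply, hM]
    split_ifs <;> simp [hc]
  have hleft : (c⁻¹ • A.transpose) * A = 1 := mul_eq_one_comm.1 hright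
  replace hleft := congrFun (congrFun hleft a) b
  rw [Matrix.smul_mul, Matrix.smul_apply, Matrix.mul_apply, Matrix.one_apply, smul_eq_mul,
    inv_mul_eq_iff_eq_mul₀ hc, mul_ite, mul_one, mul_zero] at hleft
  exact hleft

theorem sum_smul_sum_smul_eq_smul {ι κ k E : Type*} [Fintype ι] [Fintype κ] [DecidableEq ι]
    [Semiring k] [AddCommMonoid E] [Module k E] {M : ι → κ → k} {c : k}
    (hM : ∀ i j, ∑ a, M i a * M j a = if i = j then c else 0) (y : ι → E) (i : ι) :
    ∑ a, M i a • ∑ j, M j a • y j = c • y i := by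
  simp only [Finset.smul_sum, smul_smul]
  rw [Finset.sum_comm]
  simp [← Finset.sum_smul, hM, ite_smul]

theorem sum_bilin_sum_smul_eq_smul {ι κ k E F : Type*} [Fintype ι] [Fintype κ] [DecidableEq ι]
    [CommSemiring k] [AddCommMonoid E] [Module k E] [AddCommMonoid F] [Module k F]
    {M : ι → κ → k} {c : k} (hM : ∀ i j, ∑ a, M i a * M j a = if i = j then c else 0)
    (B : E →ₗ[k] E →ₗ[k] F) (e : ι → E) :
    ∑ a, B (∑ i, M i a • e i) (∑ i, M i a • e i) = c • ∑ i, B (e i) (e i) := by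
  simp only [map_sum, map_smul, LinearMap.sum_apply, LinearMap.smul_apply]
  rw [Finset.sum_comm, Finset.smul_sum]
  refine Finset.sum_congr rfl fun i _ => ?_
  simpa only [map_sum, map_smul, LinearMap.sum_apply, LinearMap.smul_apply] using
    sum_smul_sum_smul_eq_smul hM (fun j => B (e j) (e i)) i

end LinearAlgebra

section Graphs

variable {n : ℕ}

/-- The `x_a`-axis of the space of `(t, x)`. -/
def axisX (a : Fin n) : Indep n := (0, Pi.single a 1)

/-- The linear form `dx_a`. -/
noncomputable def formX (a : Fin n) : Indep n →L[ℝ] ℝ :=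
  (ContinuousLinearMap.proj a).comp (ContinuousLinearMap.snd ℝ ℝ (Fin n → ℝ))

theorem formX_axisX (a b : Fin n) : formX a (axisX b) = if a = b then 1 else 0 := by
  simp [formX, axisX, Pi.single_apply]

theorem sum_smul_axisX (y : Fin n → ℝ) : ∑ a, y a • axisX a = (0, y) := by
  ext i
  · simp [axisX, Prod.fst_sum]
  · simp [axisX, Prod.snd_sum, Finset.sum_apply, Pi.single_apply]

/-- The graph of a linear form `p`: the tangent map of a graph whose first-order jet is `p`. -/
noncomputable def graphCLM (p : Indep n →L[ℝ] ℂ) : Indep n →L[ℝ] Vars n :=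
  (ContinuousLinearMap.fst ℝ ℝ (Fin n → ℝ)).prod
    ((ContinuousLinearMap.snd ℝ ℝ (Fin n → ℝ)).prod p)

/-- The inclusion of the `ψ`-axis. -/
noncomputable def fibreCLM (n : ℕ) : ℂ →L[ℝ] Vars n :=
  (ContinuousLinearMap.inr ℝ ℝ ((Fin n → ℝ) × ℂ)).comp (ContinuousLinearMap.inr ℝ (Fin n → ℝ) ℂ)

@[simp] theorem graphCLM_apply (p : Indep n →L[ℝ] ℂ) (a : Indep n) :
    graphCLM p a = (a.1, a.2, p a) := rfl

@[simp] theorem fibreCLM_apply (w : ℂ) : fibreCLM n w = (0, 0, w) := rfl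

theorem graphCLM_eq (p : Indep n →L[ℝ] ℂ) :
    graphCLM p = graphCLM 0 + (fibreCLM n).comp p := by
  ext <;> simp

/-- The parametrization `(t, x) ↦ (t, x, u(t, x))` of the graph of `u`. -/
def graphMap (u : Indep n → ℂ) (r : Indep n) : Vars n := (r.1, r.2, u r)

variable {u : Indep n → ℂ} {q : Indep n}

theorem contDiffAt_graphMap {m : WithTop ℕ∞} (hu : ContDiffAt ℝ m u q) :
    ContDiffAt ℝ m (graphMap u) q :=
  contDiff_fst.contDiffAt.prodMk (contDiff_snd.contDiffAt.prodMk hu)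

theorem hasFDerivAt_graphMap (hu : DifferentiableAt ℝ u q) :
    HasFDerivAt (graphMap u) (graphCLM (fderiv ℝ u q)) q :=
  hasFDerivAt_fst.prodMk (hasFDerivAt_snd.prodMk hu.hasFDerivAt)

theorem fderiv_fderiv_graphMap (hu : ContDiffAt ℝ 2 u q) (a b : Indep n) :
    fderiv ℝ (fderiv ℝ (graphMap u)) q a b = (0, 0, fderiv ℝ (fderiv ℝ u) q a b) := by
  have hev : fderiv ℝ (graphMap u) =ᶠ[nhds q]
      fun r => graphCLM 0 + (fibreCLM n).comp (fderiv ℝ u r) := by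
    filter_upwards [eventually_differentiableAt_of_contDiffAt (hu.of_le one_le_two)] with r hr
    rw [(hasFDerivAt_graphMap hr).fderiv, graphCLM_eq]
  have hD := (differentiableAt_fderiv_of_contDiffAt hu).hasFDerivAt
  rw [hev.fderiv_eq, (((hasFDerivAt_const (fibreCLM n) q).clm_comp hD).const_add _).fderiv]
  simp

end Graphs

namespace PointTransformation

variable {n : ℕ} (φ : PointTransformation n)

/-- The components `(T, X)` of the transformation, the new independent variables. -/
def base (z : Vars n) : Indep n := (φ.T z, φ.X z)

variable {φ} {z : Vars n}

theorem contDiffAt_T (hz : z ∈ φ.dom) : ContDiffAt ℝ ∞ φ.T z :=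
  φ.smooth_T.contDiffAt (φ.isOpen_dom.mem_nhds hz)

theorem contDiffAt_X (hz : z ∈ φ.dom) : ContDiffAt ℝ ∞ φ.X z :=
  φ.smooth_X.contDiffAt (φ.isOpen_dom.mem_nhds hz)

theorem contDiffAt_X_apply (hz : z ∈ φ.dom) (b : Fin n) : ContDiffAt ℝ ∞ (φ.X · b) z :=
  contDiffAt_pi.1 (contDiffAt_X hz) b

theorem contDiffAt_Ψ (hz : z ∈ φ.dom) : ContDiffAt ℝ ∞ φ.Ψ z :=
  φ.smooth_Ψ.contDiffAt (φ.isOpen_dom.mem_nhds hz)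

theorem contDiffAt_base (hz : z ∈ φ.dom) : ContDiffAt ℝ ∞ φ.base z :=
  (contDiffAt_T hz).prodMk (contDiffAt_X hz)

theorem differentiableAt_T (hz : z ∈ φ.dom) : DifferentiableAt ℝ φ.T z :=
  (contDiffAt_T hz).differentiableAt (by simp)

theorem differentiableAt_X (hz : z ∈ φ.dom) : DifferentiableAt ℝ φ.X z :=
  (contDiffAt_X hz).differentiableAt (by simp)

theorem differentiableAt_Ψ (hz : z ∈ φ.dom) : DifferentiableAt ℝ φ.Ψ z :=
  (contDiffAt_Ψ hz).differentiableAt (by simp)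

theorem differentiableAt_base (hz : z ∈ φ.dom) : DifferentiableAt ℝ φ.base z :=
  (differentiableAt_T hz).prodMk (differentiableAt_X hz)

theorem fderiv_X_apply (hz : z ∈ φ.dom) (b : Fin n) (a : Vars n) :
    fderiv ℝ (φ.X · b) z a = fderiv ℝ φ.X z a b := by
  rw [fderiv_apply (differentiableAt_X hz)]
  rfl

theorem fderiv_base (hz : z ∈ φ.dom) (a : Vars n) :
    fderiv ℝ φ.base z a = (fderiv ℝ φ.T z a, fderiv ℝ φ.X z a) :=
  congrArg (· a) ((differentiableAt_T hz).fderiv_prodMk (differentiableAt_X hz))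

theorem fderiv_toMap (hz : z ∈ φ.dom) (a : Vars n) :
    fderiv ℝ φ.toMap z a = (fderiv ℝ φ.T z a, fderiv ℝ φ.X z a, fderiv ℝ φ.Ψ z a) :=
  congrArg (· a) ((differentiableAt_T hz).hasFDerivAt.prodMk
    ((differentiableAt_X hz).hasFDerivAt.prodMk (differentiableAt_Ψ hz).hasFDerivAt)).fderiv

theorem eq_zero_of_fderiv_eq_zero (hz : z ∈ φ.dom) {a : Vars n}
    (hbase : fderiv ℝ φ.base z a = 0) (hΨ : fderiv ℝ φ.Ψ z a = 0) : a = 0 := by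
  apply det_ne_zero_iff_injective.1 (φ.nondegenerate z hz)
  change fderiv ℝ φ.toMap z a = fderiv ℝ φ.toMap z 0
  rw [fderiv_base hz, Prod.mk_eq_zero] at hbase
  rw [fderiv_toMap hz, hbase.1, hbase.2, hΨ, map_zero]
  rfl

theorem surjective_fderiv_base (hz : z ∈ φ.dom) : Function.Surjective (fderiv ℝ φ.base z) := by
  intro y
  have hinj : Function.Injective (fderiv ℝ φ.toMap z : Vars n →ₗ[ℝ] Vars n) :=
    det_ne_zero_iff_injective.1 (φ.nondegenerate z hz)
  obtain ⟨a, ha⟩ := LinearMap.injective_iff_surjective.1 hinj (y.1, y.2, 0)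
  replace ha : fderiv ℝ φ.toMap z a = (y.1, y.2, 0) := ha
  rw [fderiv_toMap hz] at ha
  exact ⟨a, by rw [fderiv_base hz]; exact congrArg (fun v : Vars n => (v.1, v.2.1)) ha⟩

variable (φ) in
/-- The total Jacobian matrix `D_μ X^ν`, `X^0 = T`, at the first-order jet `(z, p)`. -/
noncomputable def totalJacobian (z : Vars n) (p : Indep n →L[ℝ] ℂ) : Indep n →L[ℝ] Indep n :=
  (fderiv ℝ φ.base z).comp (graphCLM p)

theorem totalJacobian_apply (p : Indep n →L[ℝ] ℂ) (a : Indep n) :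
    φ.totalJacobian z p a = fderiv ℝ φ.base z (a.1, a.2, p a) := rfl

theorem totalJacobian_eq_add (p : Indep n →L[ℝ] ℂ) (a : Indep n) :
    φ.totalJacobian z p a = φ.totalJacobian z 0 a + fderiv ℝ φ.base z (0, 0, p a) := by
  rw [totalJacobian_apply, totalJacobian_apply, ← map_add]
  simp

theorem continuous_totalJacobian : Continuous (φ.totalJacobian z) := by
  have : φ.totalJacobian z = fun p => (fderiv ℝ φ.base z).comp (graphCLM 0)
      + ((fderiv ℝ φ.base z).comp (fibreCLM n)).comp p := by
    funext p
    rw [totalJacobian, graphCLM_eq, ContinuousLinearMap.comp_add, ContinuousLinearMap.comp_assoc]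
  rw [this]
  fun_prop

theorem isOpen_totalJacobian_det_ne_zero : IsOpen {p | (φ.totalJacobian z p).det ≠ 0} :=
  isOpen_ne_fun (ContinuousLinearMap.continuous_det.comp continuous_totalJacobian)
    continuous_const

theorem exists_totalJacobian_det_ne_zero (hz : z ∈ φ.dom) :
    ∃ p, (φ.totalJacobian z p).det ≠ 0 := by
  let A : Indep n →ₗ[ℝ] Indep n := φ.totalJacobian z 0
  let B : ℂ →ₗ[ℝ] Indep n := (fderiv ℝ φ.base z).comp (fibreCLM n)
  have hAB : LinearMap.range A ⊔ LinearMap.range B = ⊤ := by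
    rw [eq_top_iff]
    rintro y -
    obtain ⟨a, rfl⟩ := surjective_fderiv_base hz y
    refine Submodule.mem_sup.2 ⟨A (a.1, a.2.1), ⟨_, rfl⟩, B a.2.2, ⟨_, rfl⟩, ?_⟩
    change fderiv ℝ φ.base z (a.1, a.2.1, 0) + fderiv ℝ φ.base z (0, 0, a.2.2) = _
    rw [← map_add]
    simp
  obtain ⟨p, hp⟩ := exists_injective_add_comp_of_range_sup_range_eq_top A B hAB
  refine ⟨LinearMap.toContinuousLinearMap p, det_ne_zero_iff_injective.2 ?_⟩
  convert hp using 1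
  exact funext fun a => totalJacobian_eq_add _ a

section Prolongation

variable {u v : Indep n → ℂ} {q : Indep n}

theorem contDiffAt_newIndep (hz : graphMap u q ∈ φ.dom) (hu : ContDiffAt ℝ ∞ u q) :
    ContDiffAt ℝ ∞ (φ.newIndep u) q :=
  (contDiffAt_base hz).comp q (contDiffAt_graphMap hu)

theorem fderiv_newIndep (hz : graphMap u q ∈ φ.dom) (hu : DifferentiableAt ℝ u q) :
    fderiv ℝ (φ.newIndep u) q = φ.totalJacobian (graphMap u q) (fderiv ℝ u q) :=
  ((differentiableAt_base hz).hasFDerivAt.comp q (hasFDerivAt_graphMap hu)).fderiv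

theorem exists_carriesAt (hz : graphMap u q ∈ φ.dom) (hu : ContDiffAt ℝ ∞ u q)
    (hdet : (φ.totalJacobian (graphMap u q) (fderiv ℝ u q)).det ≠ 0) :
    ∃ v, φ.CarriesAt u q v := by
  have hN := contDiffAt_newIndep hz hu
  rw [← fderiv_newIndep hz (hu.differentiableAt (by simp))] at hdet
  let e := (fderiv ℝ (φ.newIndep u) q).toContinuousLinearEquivOfDetNeZero hdet
  have he : HasFDerivAt (φ.newIndep u) (e : Indep n →L[ℝ] Indep n) q := by
    rw [ContinuousLinearMap.coe_toContinuousLinearEquivOfDetNeZero]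
    exact (hN.differentiableAt (by simp)).hasFDerivAt
  have hinv := hN.to_localInverse he (by simp)
  have himg := hN.localInverse_apply_image he (by simp)
  refine ⟨fun r => φ.Ψ (graphMap u (hN.localInverse he (by simp) r)), hz, hu, ?_, hdet, ?_⟩
  · have hΨ : ContDiffAt ℝ ∞ (fun r => φ.Ψ (graphMap u r)) q :=
      (contDiffAt_Ψ hz).comp q (contDiffAt_graphMap hu)
    rw [← himg] at hΨ
    exact hΨ.comp _ hinv
  · filter_upwards [(hN.hasStrictFDerivAt' he (by simp)).eventually_left_inverse] with r hr
    exact congrArg (fun s => φ.Ψ (graphMap u s)) hr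

namespace CarriesAt

theorem differentiableAt_source (h : φ.CarriesAt u q v) : DifferentiableAt ℝ u q :=
  h.smooth_source.differentiableAt (by simp)

theorem totalJacobian_det_ne_zero (h : φ.CarriesAt u q v) :
    (φ.totalJacobian (graphMap u q) (fderiv ℝ u q)).det ≠ 0 := by
  rw [← fderiv_newIndep h.mem_dom h.differentiableAt_source]
  exact h.total_jacobian

theorem target_eq (h : φ.CarriesAt u q v) : v (φ.newIndep u q) = φ.Ψ (graphMap u q) :=
  h.eq_near.self_of_nhds

theorem fderiv_target (h : φ.CarriesAt u q v) (a : Indep n) :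
    fderiv ℝ v (φ.newIndep u q) (φ.totalJacobian (graphMap u q) (fderiv ℝ u q) a)
      = fderiv ℝ φ.Ψ (graphMap u q) (a.1, a.2, fderiv ℝ u q a) := by
  have hz : graphMap u q ∈ φ.dom := h.mem_dom
  have hvN := fderiv_comp q (h.smooth_target.differentiableAt (by simp))
    ((contDiffAt_newIndep hz h.smooth_source).differentiableAt (by simp))
  have hΨu := fderiv_comp q (differentiableAt_Ψ hz)
    ((contDiffAt_graphMap h.smooth_source).differentiableAt (by simp))
  rw [fderiv_newIndep hz h.differentiableAt_source] at hvN
  rw [(hasFDerivAt_graphMap h.differentiableAt_source).fderiv] at hΨu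
  exact congrArg (· a) ((hvN.symm.trans (Filter.EventuallyEq.fderiv_eq h.eq_near)).trans hΨu)

theorem fderiv_fderiv_target (h : φ.CarriesAt u q v) (a b : Indep n) :
    fderiv ℝ (fderiv ℝ v) (φ.newIndep u q)
        (φ.totalJacobian (graphMap u q) (fderiv ℝ u q) a)
        (φ.totalJacobian (graphMap u q) (fderiv ℝ u q) b)
      + fderiv ℝ v (φ.newIndep u q)
        (fderiv ℝ (fderiv ℝ φ.base) (graphMap u q) (a.1, a.2, fderiv ℝ u q a)
            (b.1, b.2, fderiv ℝ u q b)
          + fderiv ℝ φ.base (graphMap u q) (0, 0, fderiv ℝ (fderiv ℝ u) q a b))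
      = fderiv ℝ (fderiv ℝ φ.Ψ) (graphMap u q) (a.1, a.2, fderiv ℝ u q a)
            (b.1, b.2, fderiv ℝ u q b)
          + fderiv ℝ φ.Ψ (graphMap u q) (0, 0, fderiv ℝ (fderiv ℝ u) q a b) := by
  have hz : graphMap u q ∈ φ.dom := h.mem_dom
  have hu := h.smooth_source.of_le two_le_infty
  have hgraph := contDiffAt_graphMap hu
  have heq : (fun r => v (φ.newIndep u r)) =ᶠ[nhds q] fun r => φ.Ψ (graphMap u r) := h.eq_near
  have hvN := fderiv_fderiv_comp (h.smooth_target.of_le two_le_infty)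
    ((contDiffAt_newIndep hz h.smooth_source).of_le two_le_infty) a b
  have hΨu := fderiv_fderiv_comp ((contDiffAt_Ψ hz).of_le two_le_infty) hgraph a b
  have hN : fderiv ℝ (fderiv ℝ (φ.newIndep u)) q a b = _ :=
    fderiv_fderiv_comp ((contDiffAt_base hz).of_le two_le_infty) hgraph a b
  rw [(heq.fderiv (𝕜 := ℝ)).fderiv_eq (𝕜 := ℝ), hΨu, hN,
    fderiv_newIndep hz h.differentiableAt_source,
    (hasFDerivAt_graphMap h.differentiableAt_source).fderiv, fderiv_fderiv_graphMap hu] at hvN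
  exact hvN.symm

end CarriesAt

end Prolongation

end PointTransformation

section Wirtinger

theorem apply_eq_mul_add_conj_mul (A : ℂ →ₗ[ℝ] ℂ) (w : ℂ) :
    A w = w * ((A 1 - Complex.I * A Complex.I) / 2)
      + conj w * ((A 1 + Complex.I * A Complex.I) / 2) := by
  have hw : A w = w.re * A 1 + w.im * A Complex.I := by
    conv_lhs => rw [← Complex.re_add_im w, ← mul_one (w.re : ℂ)]
    simp only [← Complex.real_smul, map_add, map_smul]
  have hconj : conj w = w.re - w.im * Complex.I := by
    apply Complex.ext <;> simp
  rw [hw, hconj]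
  nth_rewrite 3 [← Complex.re_add_im w]
  linear_combination (w.im : ℂ) * A Complex.I * Complex.I_sq

variable {n : ℕ} {f : Vars n → ℂ} {z : Vars n}

/-- The `x_a`-axis of the space of `(t, x, ψ)`. -/
def varsAxisX (a : Fin n) : Vars n := (0, Pi.single a 1, 0)

theorem fderiv_fibre (f : Vars n → ℂ) (z : Vars n) (w : ℂ) :
    fderiv ℝ f z (0, 0, w) = w * vdPsi f z + conj w * vdPsiBar f z :=
  apply_eq_mul_add_conj_mul ((fderiv ℝ f z).comp (fibreCLM n)) w

theorem fderiv_graph_axisX (f : Vars n → ℂ) (z : Vars n) (p : Fin n → ℂ) (a : Fin n) :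
    fderiv ℝ f z (0, Pi.single a 1, p a) = totalDX a f z p := by
  rw [totalDX, add_assoc, ← fderiv_fibre, vdX, ← map_add]
  simp

theorem fderiv_graph_time (f : Vars n → ℂ) (z : Vars n) (w : ℂ) :
    fderiv ℝ f z (1, 0, w) = vdT f z + w * vdPsi f z + conj w * vdPsiBar f z := by
  rw [add_assoc, ← fderiv_fibre, vdT, ← map_add]
  simp

theorem fderiv_vdPsi (hf : ContDiffAt ℝ 2 f z) (c : Vars n) :
    fderiv ℝ (vdPsi f) z c = (fderiv ℝ (fderiv ℝ f) z c (0, 0, 1)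
      - Complex.I * fderiv ℝ (fderiv ℝ f) z c (0, 0, Complex.I)) / 2 := by
  have hD : fderiv ℝ (vdPsi f) z = _ :=
    (((hasFDerivAt_fderiv_apply hf (0, 0, 1)).sub
      ((hasFDerivAt_fderiv_apply hf (0, 0, Complex.I)).const_mul Complex.I)).mul_const 2⁻¹).fderiv
  simp [hD, div_eq_inv_mul]

theorem fderiv_vdPsiBar (hf : ContDiffAt ℝ 2 f z) (c : Vars n) :
    fderiv ℝ (vdPsiBar f) z c = (fderiv ℝ (fderiv ℝ f) z c (0, 0, 1)
      + Complex.I * fderiv ℝ (fderiv ℝ f) z c (0, 0, Complex.I)) / 2 := by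
  have hD : fderiv ℝ (vdPsiBar f) z = _ :=
    (((hasFDerivAt_fderiv_apply hf (0, 0, 1)).add
      ((hasFDerivAt_fderiv_apply hf (0, 0, Complex.I)).const_mul Complex.I)).mul_const 2⁻¹).fderiv
  simp [hD, div_eq_inv_mul, mul_add]

theorem fderiv_fderiv_fibre (hf : ContDiffAt ℝ 2 f z) (c : Vars n) (w : ℂ) :
    fderiv ℝ (fderiv ℝ f) z c (0, 0, w)
      = w * fderiv ℝ (vdPsi f) z c + conj w * fderiv ℝ (vdPsiBar f) z c := by
  rw [fderiv_vdPsi hf, fderiv_vdPsiBar hf]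
  exact apply_eq_mul_add_conj_mul ((fderiv ℝ (fderiv ℝ f) z c).comp (fibreCLM n)) w

theorem vdPsiBar_vdPsi (hf : ContDiffAt ℝ 2 f z) :
    vdPsiBar (vdPsi f) z = vdPsi (vdPsiBar f) z := by
  rw [vdPsiBar, vdPsi, fderiv_vdPsi hf, fderiv_vdPsi hf, fderiv_vdPsiBar hf, fderiv_vdPsiBar hf,
    fderiv_fderiv_comm hf (0, 0, Complex.I) (0, 0, 1)]
  ring

theorem hatLaplacian_eq (hf : ContDiffAt ℝ 2 f z) (p : Fin n → ℂ) :
    hatLaplacian f z p = ∑ a, fderiv ℝ (fderiv ℝ f) z (0, Pi.single a 1, p a)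
      (0, Pi.single a 1, p a) := by
  refine Finset.sum_congr rfl fun a _ => ?_
  have hsplit : ((0, Pi.single a 1, p a) : Vars n) = varsAxisX a + (0, 0, p a) := by
    simp [varsAxisX]
  have hxx : vdX a (vdX a f) z = fderiv ℝ (fderiv ℝ f) z (varsAxisX a) (varsAxisX a) :=
    fderiv_fderiv_apply hf _ _
  have hψψ := fderiv_fderiv_fibre hf (0, 0, p a) (p a)
  rw [fderiv_fibre (vdPsi f), fderiv_fibre (vdPsiBar f), vdPsiBar_vdPsi hf] at hψψ
  rw [hsplit, map_add, map_add (fderiv ℝ (fderiv ℝ f) z), add_apply, add_apply, hψψ,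
    fderiv_fderiv_comm hf (0, 0, p a) (varsAxisX a), fderiv_fderiv_fibre hf (varsAxisX a), hxx]
  simp only [vdX, varsAxisX]
  ring

theorem fderiv_fibre_eq_zero_iff {g : Vars n → ℝ} (hg : DifferentiableAt ℝ g z) :
    (∀ w, fderiv ℝ g z (0, 0, w) = 0)
      ↔ vdPsi (fun y => (g y : ℂ)) z = 0 ∧ vdPsiBar (fun y => (g y : ℂ)) z = 0 := by
  have hD (a : Vars n) : fderiv ℝ (fun y => (g y : ℂ)) z a = fderiv ℝ g z a :=
    congrArg (· a) (Complex.ofRealCLM.hasFDerivAt.comp z hg.hasFDerivAt).fderiv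
  constructor
  · intro h
    simp [vdPsi, vdPsiBar, hD, h]
  · rintro ⟨hψ, hψ'⟩ w
    have hw := fderiv_fibre (fun y => (g y : ℂ)) z w
    simpa [hψ, hψ', hD] using hw

end Wirtinger

section Conformal

variable {ι κ V : Type*} [Fintype κ] [NormedAddCommGroup V] [NormedSpace ℝ V] {X : κ → V → ℝ}
  {e : ι → V} {h : V → ℝ} {z : V}

theorem sum_fderiv_fderiv_mul_of_conformal [DecidableEq ι] (hX : ∀ b, ContDiffAt ℝ 2 (X b) z)
    (hconf : ∀ᶠ y in nhds z, ∀ a c,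
      ∑ b, fderiv ℝ (X b) y (e a) * fderiv ℝ (X b) y (e c) = if a = c then h y else 0)
    (a c : ι) (d : V) :
    ∑ b, (fderiv ℝ (X b) z (e a) * fderiv ℝ (fderiv ℝ (X b)) z d (e c)
        + fderiv ℝ (fderiv ℝ (X b)) z d (e a) * fderiv ℝ (X b) z (e c))
      = if a = c then fderiv ℝ h z d else 0 := by
  have hD : fderiv ℝ (fun y => ∑ b, fderiv ℝ (X b) y (e a) * fderiv ℝ (X b) y (e c)) z = _ :=
    (HasFDerivAt.fun_sum (u := Finset.univ) fun b _ => (hasFDerivAt_fderiv_apply (hX b) (e a)).mul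
      (hasFDerivAt_fderiv_apply (hX b) (e c))).fderiv
  have hright : fderiv ℝ (fun y => if a = c then h y else 0) z
      = if a = c then fderiv ℝ h z else 0 := by
    split_ifs <;> simp
  rw [Filter.EventuallyEq.fderiv_eq (hconf.mono fun y hy => hy a c), hright] at hD
  have hDd := congrArg (· d) hD
  simp only [sum_apply, add_apply, smul_apply, ContinuousLinearMap.flip_apply, smul_eq_mul] at hDd
  rw [apply_ite (fun A : V →L[ℝ] ℝ => A d), zero_apply] at hDd
  rw [hDd]
  exact Finset.sum_congr rfl fun b _ => by ring

theorem sum_laplacian_mul_fderiv_of_conformal [Fintype ι] [DecidableEq ι]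
    (hX : ∀ b, ContDiffAt ℝ 2 (X b) z)
    (hconf : ∀ᶠ y in nhds z, ∀ a c,
      ∑ b, fderiv ℝ (X b) y (e a) * fderiv ℝ (X b) y (e c) = if a = c then h y else 0)
    (c : ι) :
    ∑ b, (∑ a, fderiv ℝ (fderiv ℝ (X b)) z (e a) (e a)) * fderiv ℝ (X b) z (e c)
      = -(((Fintype.card ι : ℝ) - 2) / 2) * fderiv ℝ h z (e c) := by
  have hdiff := sum_fderiv_fderiv_mul_of_conformal hX hconf
  have hmixed (a : ι) : ∑ b, fderiv ℝ (X b) z (e a) * fderiv ℝ (fderiv ℝ (X b)) z (e a) (e c)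
      = fderiv ℝ h z (e c) / 2 := by
    have haa := hdiff a a (e c)
    simp only [fderiv_fderiv_comm (hX _) (e c), mul_comm _ (fderiv ℝ (X _) z (e a)),
      ← two_mul, ← Finset.mul_sum, if_true] at haa
    linarith
  have htrace : ∑ a, ∑ b, fderiv ℝ (fderiv ℝ (X b)) z (e a) (e a) * fderiv ℝ (X b) z (e c)
      = ∑ a, ((if a = c then fderiv ℝ h z (e a) else 0) - fderiv ℝ h z (e c) / 2) :=
    Finset.sum_congr rfl fun a _ => by
      rw [← hdiff a c (e a), ← hmixed a, Finset.sum_add_distrib, add_sub_cancel_left]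
  simp only [Finset.sum_mul]
  rw [Finset.sum_comm, htrace, Finset.sum_sub_distrib]
  simp only [Finset.sum_ite_eq', Finset.mem_univ, if_true, Finset.sum_const, Finset.card_univ,
    nsmul_eq_mul]
  ring

end Conformal

namespace PointTransformation

variable {n : ℕ} {φ : PointTransformation n} {z : Vars n} {H : Indep n → ℝ}

theorem fderiv_fderiv_base (hz : z ∈ φ.dom) (a b : Vars n) :
    fderiv ℝ (fderiv ℝ φ.base) z a b = (fderiv ℝ (fderiv ℝ φ.T) z a b,
      fun c => fderiv ℝ (fderiv ℝ (φ.X · c)) z a b) := by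
  have hbase := (contDiffAt_base hz).of_le two_le_infty
  ext c
  · exact (fderiv_fderiv_clm_comp (.fst ℝ ℝ (Fin n → ℝ)) hbase a b).symm
  · exact (fderiv_fderiv_clm_comp (formX c) hbase a b).symm

variable (φ) in
/-- The new independent variables do not depend on `ψ`, `ψ*`. -/
def IsFibrePreserving : Prop := ∀ z ∈ φ.dom, ∀ w, fderiv ℝ φ.base z (0, 0, w) = 0

theorem isFibrePreserving_iff :
    φ.IsFibrePreserving ↔ ∀ z ∈ φ.dom,
      (vdPsi (fun y => (φ.T y : ℂ)) z = 0 ∧ vdPsiBar (fun y => (φ.T y : ℂ)) z = 0) ∧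
      ∀ a, vdPsi (fun y => (φ.X y a : ℂ)) z = 0 ∧ vdPsiBar (fun y => (φ.X y a : ℂ)) z = 0 := by
  refine forall₂_congr fun z hz => ?_
  rw [← fderiv_fibre_eq_zero_iff (differentiableAt_T hz)]
  simp only [← fderiv_fibre_eq_zero_iff
    ((contDiffAt_X_apply hz _).differentiableAt (by simp)), fderiv_X_apply hz, fderiv_base hz,
    Prod.mk_eq_zero, funext_iff, Pi.zero_apply]
  exact ⟨fun h => ⟨fun w => (h w).1, fun a w => (h w).2 a⟩,
    fun h w => ⟨h.1 w, fun a => h.2 a w⟩⟩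

namespace IsFibrePreserving

theorem totalJacobian_eq (h : φ.IsFibrePreserving) (hz : z ∈ φ.dom) (p : Indep n →L[ℝ] ℂ) :
    φ.totalJacobian z p = φ.totalJacobian z 0 := by
  refine ContinuousLinearMap.ext fun a => ?_
  rw [totalJacobian_eq_add, h z hz, add_zero]

theorem totalJacobian_det_ne_zero (h : φ.IsFibrePreserving) (hz : z ∈ φ.dom)
    (p : Indep n →L[ℝ] ℂ) : (φ.totalJacobian z p).det ≠ 0 := by
  obtain ⟨p₀, hp₀⟩ := exists_totalJacobian_det_ne_zero hz
  rwa [h.totalJacobian_eq hz, ← h.totalJacobian_eq hz p₀]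

theorem fderiv_fderiv_base_fibre (h : φ.IsFibrePreserving) (hz : z ∈ φ.dom) (a : Vars n) (w : ℂ) :
    fderiv ℝ (fderiv ℝ φ.base) z a (0, 0, w) = 0 := by
  have hev : (fun y => fderiv ℝ φ.base y (0, 0, w)) =ᶠ[nhds z] fun _ => 0 := by
    filter_upwards [φ.isOpen_dom.mem_nhds hz] with y hy using h y hy w
  rw [← fderiv_fderiv_apply ((contDiffAt_base hz).of_le two_le_infty), hev.fderiv_eq]
  simp

theorem fderiv_fderiv_base_add_fibre (h : φ.IsFibrePreserving) (hz : z ∈ φ.dom) (a : Vars n)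
    (w : ℂ) :
    fderiv ℝ (fderiv ℝ φ.base) z (a + (0, 0, w)) (a + (0, 0, w))
      = fderiv ℝ (fderiv ℝ φ.base) z a a := by
  rw [map_add, h.fderiv_fderiv_base_fibre hz, add_zero,
    fderiv_fderiv_comm ((contDiffAt_base hz).of_le two_le_infty), map_add,
    h.fderiv_fderiv_base_fibre hz, add_zero]

end IsFibrePreserving

variable (φ) in
theorem isOpen_indepDom : IsOpen φ.indepDom := by
  rw [isOpen_iff_mem_nhds]
  rintro _ ⟨z, hz, rfl⟩
  have hc : ContinuousAt (fun q : Indep n => ((q.1, q.2, z.2.2) : Vars n)) (z.1, z.2.1) := by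
    fun_prop
  filter_upwards [hc.preimage_mem_nhds (φ.isOpen_dom.mem_nhds hz)] with q hq
  exact ⟨_, hq, rfl⟩

theorem indep_mem_indepDom (hz : z ∈ φ.dom) : (z.1, z.2.1) ∈ φ.indepDom := ⟨z, hz, rfl⟩

namespace IsConformalWith

theorem isFibrePreserving (h : φ.IsConformalWith H) : φ.IsFibrePreserving :=
  isFibrePreserving_iff.2 fun z hz =>
    ⟨⟨h.T_psi z hz, h.T_psiBar z hz⟩, fun a => ⟨h.X_psi z hz a, h.X_psiBar z hz a⟩⟩

theorem H_ne_zero (h : φ.IsConformalWith H) (hz : z ∈ φ.dom) : H (z.1, z.2.1) ≠ 0 :=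
  (h.H_pos _ (indep_mem_indepDom hz)).ne'

theorem totalJacobian_axisX (h : φ.IsConformalWith H) (hz : z ∈ φ.dom) (p : Indep n →L[ℝ] ℂ)
    (a : Fin n) :
    φ.totalJacobian z p (axisX a) = ∑ b, vdX a (φ.X · b) z • axisX b := by
  rw [h.isFibrePreserving.totalJacobian_eq hz, sum_smul_axisX, totalJacobian_apply, fderiv_base hz]
  exact Prod.ext (h.T_x z hz a) (funext fun b => (fderiv_X_apply hz b _).symm)

theorem totalJacobian_time (h : φ.IsConformalWith H) (hz : z ∈ φ.dom) (p : Indep n →L[ℝ] ℂ) :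
    φ.totalJacobian z p (1, 0)
      = vdT φ.T z • ((1, 0) : Indep n) + ∑ b, vdT (φ.X · b) z • axisX b := by
  rw [h.isFibrePreserving.totalJacobian_eq hz, sum_smul_axisX, totalJacobian_apply, fderiv_base hz]
  ext b
  · simp [vdT]
  · simpa [vdT] using (fderiv_X_apply hz b _).symm

theorem fderiv_fderiv_base_axisX (h : φ.IsConformalWith H) (hz : z ∈ φ.dom) (a : Fin n) (w : ℂ) :
    fderiv ℝ (fderiv ℝ φ.base) z (0, Pi.single a 1, w) (0, Pi.single a 1, w)
      = ∑ b, fderiv ℝ (fderiv ℝ (φ.X · b)) z (varsAxisX a) (varsAxisX a) • axisX b := by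
  have hsplit : ((0, Pi.single a 1, w) : Vars n) = varsAxisX a + (0, 0, w) := by
    simp [varsAxisX]
  have hT : vdX a φ.T =ᶠ[nhds z] fun _ => 0 := by
    filter_upwards [φ.isOpen_dom.mem_nhds hz] with y hy using h.T_x y hy a
  have hTxx : fderiv ℝ (fderiv ℝ φ.T) z (varsAxisX a) (varsAxisX a) = 0 := by
    rw [← fderiv_fderiv_apply ((contDiffAt_T hz).of_le two_le_infty)]
    change fderiv ℝ (vdX a φ.T) z (varsAxisX a) = 0
    rw [hT.fderiv_eq]
    simp
  rw [hsplit, h.isFibrePreserving.fderiv_fderiv_base_add_fibre hz, fderiv_fderiv_base hz, hTxx,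
    sum_smul_axisX]

theorem conformal_transpose (h : φ.IsConformalWith H) (hz : z ∈ φ.dom) (a c : Fin n) :
    ∑ b, vdX a (φ.X · b) z * vdX c (φ.X · b) z = if a = c then H (z.1, z.2.1) else 0 :=
  sum_mul_eq_ite_of_sum_mul_eq_ite (h.H_ne_zero hz) (h.conformal z hz) a c

theorem sum_laplacian_X_mul (h : φ.IsConformalWith H) (hz : z ∈ φ.dom) (c : Fin n) :
    ∑ b, (∑ a, fderiv ℝ (fderiv ℝ (φ.X · b)) z (varsAxisX a) (varsAxisX a)) * vdX c (φ.X · b) z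
      = -(((n : ℝ) - 2) / 2) * pdX c H (z.1, z.2.1) := by
  have hconf : ∀ᶠ y in nhds z, ∀ a c, ∑ b, fderiv ℝ (φ.X · b) y (varsAxisX a)
      * fderiv ℝ (φ.X · b) y (varsAxisX c) = if a = c then H (y.1, y.2.1) else 0 := by
    filter_upwards [φ.isOpen_dom.mem_nhds hz] with y hy using h.conformal_transpose hy
  let π : Vars n →L[ℝ] Indep n := (ContinuousLinearMap.fst ℝ ℝ ((Fin n → ℝ) × ℂ)).prod
    ((ContinuousLinearMap.fst ℝ (Fin n → ℝ) ℂ).comp (ContinuousLinearMap.snd ℝ ℝ ((Fin n → ℝ) × ℂ)))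
  have hH : DifferentiableAt ℝ H (π z) := (h.smooth_H.contDiffAt
    (φ.isOpen_indepDom.mem_nhds (indep_mem_indepDom hz))).differentiableAt (by simp)
  have hHπ : fderiv ℝ (fun y => H (π y)) z = (fderiv ℝ H (π z)).comp π :=
    (hH.hasFDerivAt.comp z π.hasFDerivAt).fderiv
  have hlap := sum_laplacian_mul_fderiv_of_conformal
    (fun b => (contDiffAt_X_apply hz b).of_le two_le_infty) hconf c
  rw [Fintype.card_fin] at hlap
  exact hlap.trans (congrArg (fun A => -(((n : ℝ) - 2) / 2) * A (varsAxisX c)) hHπ)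

end IsConformalWith

end PointTransformation

namespace PointTransformation

variable {n : ℕ} {φ : PointTransformation n} {H : Indep n → ℝ} {u v : Indep n → ℂ} {q : Indep n}

namespace CarriesAt

theorem sum_vdX_smul_pdX_target (h : φ.CarriesAt u q v) (hc : φ.IsConformalWith H) (a : Fin n) :
    ∑ b, vdX a (φ.X · b) (graphMap u q) • pdX b v (φ.newIndep u q)
      = totalDX a φ.Ψ (graphMap u q) (pdX · u q) := by
  have hz : graphMap u q ∈ φ.dom := h.mem_dom
  have hDv := h.fderiv_target (axisX a)
  rw [hc.totalJacobian_axisX hz, map_sum] at hDv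
  simp only [map_smul] at hDv
  exact hDv.trans (fderiv_graph_axisX φ.Ψ (graphMap u q) (pdX · u q) a)

theorem smul_pdX_target (h : φ.CarriesAt u q v) (hc : φ.IsConformalWith H) (b : Fin n) :
    H q • pdX b v (φ.newIndep u q)
      = ∑ a, vdX a (φ.X · b) (graphMap u q) • totalDX a φ.Ψ (graphMap u q) (pdX · u q) := by
  have hz : graphMap u q ∈ φ.dom := h.mem_dom
  simp only [← h.sum_vdX_smul_pdX_target hc]
  exact (sum_smul_sum_smul_eq_smul (hc.conformal _ hz) (pdX · v (φ.newIndep u q)) b).symm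

theorem smul_pdX_target_eq_sum (h : φ.CarriesAt u q v) (hc : φ.IsConformalWith H) (c : ℝ)
    (b : Fin n) :
    c • pdX b v (φ.newIndep u q)
      = ∑ a, ((c * vdX a (φ.X · b) (graphMap u q) / H q : ℝ) : ℂ)
        * totalDX a φ.Ψ (graphMap u q) (pdX · u q) := by
  have hH : H q ≠ 0 := hc.H_ne_zero h.mem_dom
  rw [← inv_smul_smul₀ hH (pdX b v _), h.smul_pdX_target hc, smul_smul, Finset.smul_sum]
  refine Finset.sum_congr rfl fun a _ => ?_
  rw [smul_smul, Complex.real_smul]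
  congr 2
  ring

theorem gradJet_target (h : φ.CarriesAt u q v) (hc : φ.IsConformalWith H) :
    gradJet v (φ.newIndep u q) = φ.newGradVars H (graphMap u q) (pdX · u q) := by
  refine Prod.ext ?_ (funext fun b => ?_)
  · simp only [gradJet, h.target_eq]
    rfl
  · have hb := h.smul_pdX_target_eq_sum hc 1 b
    simp only [one_smul, one_mul] at hb
    exact hb

theorem vdT_mul_pdT_target (h : φ.CarriesAt u q v) (hc : φ.IsConformalWith H) :
    ((vdT φ.T (graphMap u q) : ℝ) : ℂ) * pdT v (φ.newIndep u q)
      = vdT φ.Ψ (graphMap u q) + pdT u q * vdPsi φ.Ψ (graphMap u q)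
        + conj (pdT u q) * vdPsiBar φ.Ψ (graphMap u q)
        - ∑ b, ∑ a, ((vdT (φ.X · b) (graphMap u q) * vdX a (φ.X · b) (graphMap u q) / H q : ℝ) : ℂ)
            * totalDX a φ.Ψ (graphMap u q) (pdX · u q) := by
  have hz : graphMap u q ∈ φ.dom := h.mem_dom
  have hDv := h.fderiv_target (1, 0)
  rw [hc.totalJacobian_time hz, map_add, map_sum, fderiv_graph_time, map_smul,
    Complex.real_smul] at hDv
  simp only [map_smul] at hDv
  simp only [← h.smul_pdX_target_eq_sum hc]
  exact eq_sub_of_add_eq hDv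

theorem sum_fderiv_fderiv_target (h : φ.CarriesAt u q v) (hc : φ.IsConformalWith H) :
    ∑ a, fderiv ℝ (fderiv ℝ v) (φ.newIndep u q)
        (φ.totalJacobian (graphMap u q) (fderiv ℝ u q) (axisX a))
        (φ.totalJacobian (graphMap u q) (fderiv ℝ u q) (axisX a))
      = (H q : ℂ) * ∑ b, pdX b (pdX b v) (φ.newIndep u q) := by
  have hz : graphMap u q ∈ φ.dom := h.mem_dom
  have hv (b : Fin n) : pdX b (pdX b v) (φ.newIndep u q)
      = fderiv ℝ (fderiv ℝ v) (φ.newIndep u q) (axisX b) (axisX b) :=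
    fderiv_fderiv_apply (h.smooth_target.of_le two_le_infty) _ _
  simp only [hc.totalJacobian_axisX hz, hv, ← Complex.real_smul]
  exact sum_bilin_sum_smul_eq_smul (hc.conformal _ hz)
    (fderiv ℝ (fderiv ℝ v) (φ.newIndep u q)).toLinearMap₁₂ axisX

theorem sum_fderiv_target_fderiv_fderiv_base (h : φ.CarriesAt u q v) (hc : φ.IsConformalWith H) :
    ∑ a, fderiv ℝ v (φ.newIndep u q) (fderiv ℝ (fderiv ℝ φ.base) (graphMap u q)
        (0, Pi.single a 1, fderiv ℝ u q (axisX a)) (0, Pi.single a 1, fderiv ℝ u q (axisX a)))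
      = -(((n : ℂ) - 2) / 2 * ∑ a, ((pdX a H q / H q : ℝ) : ℂ)
          * totalDX a φ.Ψ (graphMap u q) (pdX · u q)) := by
  have hz : graphMap u q ∈ φ.dom := h.mem_dom
  let lapX (b : Fin n) : ℝ :=
    ∑ a, fderiv ℝ (fderiv ℝ (φ.X · b)) (graphMap u q) (varsAxisX a) (varsAxisX a)
  have hlapX : ∑ a, fderiv ℝ v (φ.newIndep u q) (fderiv ℝ (fderiv ℝ φ.base) (graphMap u q)
        (0, Pi.single a 1, fderiv ℝ u q (axisX a)) (0, Pi.single a 1, fderiv ℝ u q (axisX a)))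
      = ∑ b, lapX b • pdX b v (φ.newIndep u q) := by
    simp only [hc.fderiv_fderiv_base_axisX hz, map_sum, map_smul, lapX, Finset.sum_smul]
    exact Finset.sum_comm
  have hcoeff (a : Fin n) : ∑ b, lapX b * vdX a (φ.X · b) (graphMap u q)
      = -(((n : ℝ) - 2) / 2) * pdX a H q :=
    hc.sum_laplacian_X_mul hz a
  simp only [hlapX, h.smul_pdX_target_eq_sum hc]
  rw [Finset.sum_comm, Finset.mul_sum, ← Finset.sum_neg_distrib]
  refine Finset.sum_congr rfl fun a _ => ?_
  rw [← Finset.sum_mul, ← Complex.ofReal_sum, ← Finset.sum_div, hcoeff]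
  push_cast
  ring

theorem mul_laplacian_target (h : φ.CarriesAt u q v) (hc : φ.IsConformalWith H) :
    (H q : ℂ) * ∑ b, pdX b (pdX b v) (φ.newIndep u q)
      = hatLaplacian φ.Ψ (graphMap u q) (pdX · u q)
        + ((n : ℂ) - 2) / 2 * ∑ a, ((pdX a H q / H q : ℝ) : ℂ)
          * totalDX a φ.Ψ (graphMap u q) (pdX · u q)
        + (∑ a, pdX a (pdX a u) q) * vdPsi φ.Ψ (graphMap u q)
        + conj (∑ a, pdX a (pdX a u) q) * vdPsiBar φ.Ψ (graphMap u q) := by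
  have hz : graphMap u q ∈ φ.dom := h.mem_dom
  have hsum := Finset.sum_congr (M := ℂ) rfl fun a (_ : a ∈ Finset.univ) =>
    h.fderiv_fderiv_target (axisX a) (axisX a)
  simp only [hc.isFibrePreserving _ hz, add_zero, Finset.sum_add_distrib,
    h.sum_fderiv_fderiv_target hc] at hsum
  have hbase := h.sum_fderiv_target_fderiv_fderiv_base hc
  have hhat := hatLaplacian_eq ((contDiffAt_Ψ hz).of_le two_le_infty) (pdX · u q)
  have hu (a : Fin n) : pdX a (pdX a u) q = fderiv ℝ (fderiv ℝ u) q (axisX a) (axisX a) :=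
    fderiv_fderiv_apply (h.smooth_source.of_le two_le_infty) _ _
  have hfibre : ∑ a, fderiv ℝ φ.Ψ (graphMap u q)
        (0, 0, fderiv ℝ (fderiv ℝ u) q (axisX a) (axisX a))
      = (∑ a, pdX a (pdX a u) q) * vdPsi φ.Ψ (graphMap u q)
        + conj (∑ a, pdX a (pdX a u) q) * vdPsiBar φ.Ψ (graphMap u q) := by
    simp only [hu, fderiv_fibre, Finset.sum_add_distrib, map_sum, Finset.sum_mul]
  have hcombined := (congrArg (_ + ·) hbase).symm.trans (hsum.trans
    (congrArg₂ (· + ·) hhat.symm hfibre))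
  linear_combination hcombined

theorem transformed_equation (h : φ.CarriesAt u q v) (hc : φ.IsConformalWith H)
    (F : GradVars n → ℂ) (g f : ℂ) :
    ((vdT φ.T (graphMap u q) : ℝ) : ℂ) * (Complex.I * pdT v (φ.newIndep u q)
        + g * ∑ b, pdX b (pdX b v) (φ.newIndep u q) + f)
      = vdPsi φ.Ψ (graphMap u q) * (Complex.I * pdT u q
          + ((vdT φ.T (graphMap u q) / H q : ℝ) : ℂ) * g * ∑ a, pdX a (pdX a u) q + F (gradJet u q))
        - vdPsiBar φ.Ψ (graphMap u q) * conj (Complex.I * pdT u q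
          - conj (((vdT φ.T (graphMap u q) / H q : ℝ) : ℂ) * g) * ∑ a, pdX a (pdX a u) q
          + F (gradJet u q))
        + ((vdT φ.T (graphMap u q) : ℝ) : ℂ) * (f - φ.newF H F g (graphMap u q) (pdX · u q)) := by
  have hH : (H q : ℂ) ≠ 0 := Complex.ofReal_ne_zero.2 (hc.H_ne_zero h.mem_dom)
  have hT : ((vdT φ.T (graphMap u q) : ℝ) : ℂ) ≠ 0 := Complex.ofReal_ne_zero.2 (hc.T_t _ h.mem_dom)
  have hgrad : gradJet u q = (graphMap u q, (pdX · u q)) := rfl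
  have hq : ((graphMap u q).1, (graphMap u q).2.1) = q := rfl
  have hlap := (eq_inv_mul_iff_mul_eq₀ hH).2 (h.mul_laplacian_target hc)
  have htime := (eq_inv_mul_iff_mul_eq₀ hT).2 (h.vdT_mul_pdT_target hc)
  rw [hlap, htime]
  simp only [newF, hgrad, hq, map_add, map_sub, map_mul, Complex.conj_conj,
    Complex.conj_I, Complex.ofReal_div]
  field_simp
  ring

end CarriesAt

theorem IsConformalWith.eq_zero_of_wirtinger (h : φ.IsConformalWith H) {z : Vars n}
    (hz : z ∈ φ.dom) {w : ℂ} (hw : vdPsi φ.Ψ z * w - vdPsiBar φ.Ψ z * conj w = 0) : w = 0 := by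
  have hΨ : fderiv ℝ φ.Ψ z (0, 0, Complex.I * w) = 0 := by
    rw [fderiv_fibre, map_mul, Complex.conj_I]
    linear_combination Complex.I * hw
  have hIw := eq_zero_of_fderiv_eq_zero hz (h.isFibrePreserving z hz _) hΨ
  simpa using congrArg (fun y : Vars n => y.2.2) hIw

end PointTransformation

theorem exists_symm_bilin_trace_eq {n : ℕ} [NeZero n] (σ : ℂ) :
    ∃ B : Indep n →L[ℝ] Indep n →L[ℝ] ℂ,
      (∀ a b, B a b = B b a) ∧ ∑ a, B (axisX a) (axisX a) = σ :=
  ⟨(formX 0).smulRight ((formX 0).smulRight σ), fun a b => by simp [mul_left_comm],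
    by simp only [ContinuousLinearMap.smulRight_apply, smul_apply, formX_axisX]; simp⟩

theorem sum_pdX_pdX {n : ℕ} {E : Type*} [NormedAddCommGroup E] [NormedSpace ℝ E]
    {u : Indep n → E} {q : Indep n} (hu : ContDiffAt ℝ 2 u q) :
    ∑ a, pdX a (pdX a u) q = ∑ a, fderiv ℝ (fderiv ℝ u) q (axisX a) (axisX a) :=
  Finset.sum_congr rfl fun _ _ => fderiv_fderiv_apply hu _ _

theorem ClassN.HoldsAt.holdsAt_iff_laplacian_eq {n : ℕ} {V : Set (Vars n)} {L : ClassN n V}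
    {u u' : Indep n → ℂ} {q : Indep n} (h : L.HoldsAt u q) (hV : graphMap u q ∈ V)
    (hu : u' q = u q) (hDu : fderiv ℝ u' q = fderiv ℝ u q) :
    L.HoldsAt u' q ↔ ∑ a, pdX a (pdX a u') q = ∑ a, pdX a (pdX a u) q := by
  have hjet : gradJet u' q = gradJet u q := by simp [gradJet, pdX, hu, hDu]
  have ht : pdT u' q = pdT u q := by simp [pdT, hDu]
  unfold ClassN.HoldsAt at h ⊢
  rw [hjet, ht, ← h, add_left_inj, add_right_inj]
  exact mul_right_inj' (L.G_ne_zero _ hV _)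

namespace PointTransformation

variable {n : ℕ} {φ : PointTransformation n} {z : Vars n}

theorem totalJacobian_add (p δ : Indep n →L[ℝ] ℂ) (b : Indep n) :
    φ.totalJacobian z (p + δ) b = φ.totalJacobian z p b + fderiv ℝ φ.base z (0, 0, δ b) := by
  rw [totalJacobian_eq_add (p + δ), totalJacobian_eq_add p, add_assoc, ← map_add]
  simp

theorem exists_ne_zero_totalJacobian_add_smul_det_ne_zero {p : Indep n →L[ℝ] ℂ}
    (hp : (φ.totalJacobian z p).det ≠ 0) (δ : Indep n →L[ℝ] ℂ) :
    ∃ s : ℝ, s ≠ 0 ∧ (φ.totalJacobian z (p + s • δ)).det ≠ 0 ∧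
      (φ.totalJacobian z (p + (-s) • δ)).det ≠ 0 := by
  have hnear : ∀ᶠ s : ℝ in nhds 0, (φ.totalJacobian z (p + s • δ)).det ≠ 0 := by
    have hcont : Continuous fun s : ℝ => p + s • δ := by fun_prop
    exact (hcont.tendsto' 0 p (by rw [zero_smul ℝ δ, add_zero])).eventually_mem
      (isOpen_totalJacobian_det_ne_zero.mem_nhds hp)
  have hnear' : ∀ᶠ s : ℝ in nhds 0, (φ.totalJacobian z (p + (-s) • δ)).det ≠ 0 :=
    (continuous_neg.tendsto' 0 0 neg_zero).eventually hnear
  have hpunctured : ∀ᶠ s : ℝ in nhdsWithin 0 {0}ᶜ, s ≠ 0 := self_mem_nhdsWithin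
  exact (hpunctured.and ((hnear.and hnear').filter_mono nhdsWithin_le_nhds)).exists

theorem exists_carriesAt_of_jet (hz : z ∈ φ.dom) {p : Indep n →L[ℝ] ℂ}
    (hdet : (φ.totalJacobian z p).det ≠ 0) {B : Indep n →L[ℝ] Indep n →L[ℝ] ℂ}
    (hB : ∀ a b, B a b = B b a) :
    ∃ u v, φ.CarriesAt u (z.1, z.2.1) v ∧ graphMap u (z.1, z.2.1) = z ∧
      fderiv ℝ u (z.1, z.2.1) = p ∧ fderiv ℝ (fderiv ℝ u) (z.1, z.2.1) = B := by
  obtain ⟨u, hu, hu₀, hu₁, hu₂⟩ := exists_contDiff_of_jet (z.1, z.2.1) z.2.2 p hB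
  have hgraph : graphMap u (z.1, z.2.1) = z := by simp [graphMap, hu₀]
  obtain ⟨v, hv⟩ := exists_carriesAt (φ := φ) (q := (z.1, z.2.1)) (by rwa [hgraph])
    (hu.contDiffAt.of_le le_top) (by rwa [hgraph, hu₁])
  exact ⟨u, v, hv, hgraph, hu₁, hu₂⟩

namespace CarriesAt

variable {u v u' v' : Indep n → ℂ} {q : Indep n}

theorem exists_totalJacobian_eq (h : φ.CarriesAt u q v) (b : Indep n) :
    ∃ a, φ.totalJacobian (graphMap u q) (fderiv ℝ u q) a = b :=
  LinearMap.injective_iff_surjective.1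
    (det_ne_zero_iff_injective.1 h.totalJacobian_det_ne_zero) b

theorem eq_zero_of_fderiv_target_eq (h : φ.CarriesAt u q v) {w : ℂ}
    (hw : fderiv ℝ v (φ.newIndep u q) (fderiv ℝ φ.base (graphMap u q) (0, 0, w))
      = fderiv ℝ φ.Ψ (graphMap u q) (0, 0, w)) : w = 0 := by
  obtain ⟨a, ha⟩ := h.exists_totalJacobian_eq (fderiv ℝ φ.base (graphMap u q) (0, 0, w))
  have hΨ := h.fderiv_target a
  rw [ha, hw] at hΨ
  have hkernel : graphCLM (fderiv ℝ u q) a - (0, 0, w) = 0 := by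
    apply eq_zero_of_fderiv_eq_zero h.mem_dom
    · rw [map_sub, sub_eq_zero]
      exact ha
    · rw [map_sub, sub_eq_zero]
      exact hΨ.symm
  simp only [graphCLM_apply, sub_eq_zero, Prod.mk.injEq] at hkernel
  have ha₀ : a = 0 := Prod.ext hkernel.1 hkernel.2.1
  rw [← hkernel.2.2, ha₀, map_zero]

theorem fderiv_target_congr (h : φ.CarriesAt u q v) (h' : φ.CarriesAt u' q v')
    (hu : graphMap u' q = graphMap u q) (hDu : fderiv ℝ u' q = fderiv ℝ u q) :
    fderiv ℝ v' (φ.newIndep u q) = fderiv ℝ v (φ.newIndep u q) := by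
  have hN : φ.newIndep u' q = φ.newIndep u q := congrArg φ.base hu
  refine ContinuousLinearMap.ext fun b => ?_
  obtain ⟨a, rfl⟩ := h.exists_totalJacobian_eq b
  have ha' := h'.fderiv_target a
  rw [hN, hu, hDu, ← h.fderiv_target a] at ha'
  exact ha'

theorem fderiv_fderiv_target_sub (h : φ.CarriesAt u q v) (h' : φ.CarriesAt u' q v')
    (hu : graphMap u' q = graphMap u q) (hDu : fderiv ℝ u' q = fderiv ℝ u q)
    {B : Indep n →L[ℝ] Indep n →L[ℝ] ℂ}
    (hB : fderiv ℝ (fderiv ℝ u') q = fderiv ℝ (fderiv ℝ u) q + B) (a b : Indep n) :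
    fderiv ℝ (fderiv ℝ v') (φ.newIndep u q)
        (φ.totalJacobian (graphMap u q) (fderiv ℝ u q) a)
        (φ.totalJacobian (graphMap u q) (fderiv ℝ u q) b)
      - fderiv ℝ (fderiv ℝ v) (φ.newIndep u q)
        (φ.totalJacobian (graphMap u q) (fderiv ℝ u q) a)
        (φ.totalJacobian (graphMap u q) (fderiv ℝ u q) b)
      = fderiv ℝ φ.Ψ (graphMap u q) (0, 0, B a b)
        - fderiv ℝ v (φ.newIndep u q) (fderiv ℝ φ.base (graphMap u q) (0, 0, B a b)) := by
  have hN : φ.newIndep u' q = φ.newIndep u q := congrArg φ.base hu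
  have hv := h.fderiv_fderiv_target a b
  have hv' := h'.fderiv_fderiv_target a b
  have hsplit : ((0, 0, fderiv ℝ (fderiv ℝ u') q a b) : Vars n)
      = (0, 0, fderiv ℝ (fderiv ℝ u) q a b) + (0, 0, B a b) := by
    simp [hB]
  rw [hN, hu, hDu, h.fderiv_target_congr h' hu hDu, hsplit, map_add (fderiv ℝ φ.base _),
    map_add (fderiv ℝ φ.Ψ _), ← add_assoc (fderiv ℝ (fderiv ℝ φ.base) _ _ _), map_add _ (_ + _),
    ← add_assoc (fderiv ℝ (fderiv ℝ φ.Ψ) _ _ _), ← hv] at hv'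
  linear_combination hv'

theorem sum_bilin_symm_eq_zero (h : φ.CarriesAt u q v) (h' : φ.CarriesAt u' q v')
    (hu : graphMap u' q = graphMap u q) (hDu : fderiv ℝ u' q = fderiv ℝ u q)
    {B : Indep n →L[ℝ] Indep n →L[ℝ] ℂ}
    (hB : fderiv ℝ (fderiv ℝ u') q = fderiv ℝ (fderiv ℝ u) q + B)
    (hΔv : ∑ a, pdX a (pdX a v') (φ.newIndep u q) = ∑ a, pdX a (pdX a v) (φ.newIndep u q))
    {N : Indep n ≃L[ℝ] Indep n} (hN : N = φ.totalJacobian (graphMap u q) (fderiv ℝ u q)) :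
    ∑ a, B (N.symm (axisX a)) (N.symm (axisX a)) = 0 := by
  have hv' : ContDiffAt ℝ 2 v' (φ.newIndep u q) := by
    rw [show φ.newIndep u q = φ.newIndep u' q from (congrArg φ.base hu).symm]
    exact h'.smooth_target.of_le two_le_infty
  have hJN (b : Indep n) :
      φ.totalJacobian (graphMap u q) (fderiv ℝ u q) (N.symm b) = b := by
    rw [← hN]
    exact N.apply_symm_apply b
  have hsub (a : Fin n) := h.fderiv_fderiv_target_sub h' hu hDu hB (N.symm (axisX a))
    (N.symm (axisX a))
  simp only [hJN, ← fibreCLM_apply] at hsub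
  rw [sum_pdX_pdX hv', sum_pdX_pdX (h.smooth_target.of_le two_le_infty), ← sub_eq_zero,
    ← Finset.sum_sub_distrib] at hΔv
  simp only [hsub, Finset.sum_sub_distrib, ← map_sum] at hΔv
  exact h.eq_zero_of_fderiv_target_eq (sub_eq_zero.1 hΔv).symm

end CarriesAt

namespace IsAdmissible

variable {L : ClassN n φ.dom} {L' : ClassN n φ.image}

theorem laplacian_target_congr (had : φ.IsAdmissible L L') {u v u' v' : Indep n → ℂ}
    {q : Indep n} (h : φ.CarriesAt u q v) (h' : φ.CarriesAt u' q v')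
    (hu : graphMap u' q = graphMap u q) (hDu : fderiv ℝ u' q = fderiv ℝ u q)
    (hΔu : ∑ a, pdX a (pdX a u') q = ∑ a, pdX a (pdX a u) q) (hL : L.HoldsAt u q) :
    ∑ a, pdX a (pdX a v') (φ.newIndep u q) = ∑ a, pdX a (pdX a v) (φ.newIndep u q) := by
  have hN : φ.newIndep u' q = φ.newIndep u q := congrArg φ.base hu
  have hu₀ : u' q = u q := congrArg (fun y : Vars n => y.2.2) hu
  have hL' := (had u' q v' h').1 ((hL.holdsAt_iff_laplacian_eq h.mem_dom hu₀ hDu).2 hΔu)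
  rw [hN] at hL'
  have hv₀ : v' (φ.newIndep u q) = v (φ.newIndep u q) := by
    rw [h.target_eq, ← hN, h'.target_eq, hu]
  have himage : graphMap v (φ.newIndep u q) ∈ φ.image := by
    refine ⟨graphMap u q, h.mem_dom, ?_⟩
    simp only [graphMap, h.target_eq]
    rfl
  exact (((had u q v h).1 hL).holdsAt_iff_laplacian_eq himage hv₀
    (h.fderiv_target_congr h' hu hDu)).1 hL'

theorem sum_bilin_symm_eq_zero [NeZero n] (had : φ.IsAdmissible L L') (hz : z ∈ φ.dom)
    {p : Indep n →L[ℝ] ℂ} {N : Indep n ≃L[ℝ] Indep n} (hN : N = φ.totalJacobian z p)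
    {B : Indep n →L[ℝ] Indep n →L[ℝ] ℝ} (hB : ∀ a b, B a b = B b a)
    (htrace : ∑ a, B (axisX a) (axisX a) = 0) :
    ∑ a, B (N.symm (axisX a)) (N.symm (axisX a)) = 0 := by
  have hdet : (φ.totalJacobian z p).det ≠ 0 := by
    rw [← hN]
    exact det_ne_zero_iff_injective.2 N.injective
  let y : GradVars n := (z, fun a => p (axisX a))
  obtain ⟨B₀, hB₀, htrace₀⟩ := exists_symm_bilin_trace_eq (n := n)
    (-(Complex.I * p (1, 0) + L.F y) / L.G y)
  let Bc := (ContinuousLinearMap.compL ℝ (Indep n) ℝ ℂ Complex.ofRealCLM).comp B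
  obtain ⟨u, v, h, hu, hDu, hDDu⟩ := exists_carriesAt_of_jet hz hdet hB₀
  obtain ⟨u', v', h', hu', hDu', hDDu'⟩ := exists_carriesAt_of_jet hz hdet (B := B₀ + Bc)
    (fun a b => by simp [hB₀ a, hB a, Bc])
  have hL : L.HoldsAt u (z.1, z.2.1) := by
    have hjet : gradJet u (z.1, z.2.1) = y :=
      Prod.ext hu (funext fun a => congrArg (· (axisX a)) hDu)
    have hG : L.G y ≠ 0 := L.G_ne_zero z hz _
    rw [ClassN.HoldsAt, hjet, sum_pdX_pdX (h.smooth_source.of_le two_le_infty), hDDu, htrace₀,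
      pdT, hDu, mul_div_cancel₀ _ hG]
    ring
  have hΔu : ∑ a, pdX a (pdX a u') (z.1, z.2.1) = ∑ a, pdX a (pdX a u) (z.1, z.2.1) := by
    rw [sum_pdX_pdX (h.smooth_source.of_le two_le_infty),
      sum_pdX_pdX (h'.smooth_source.of_le two_le_infty), hDDu, hDDu']
    simp [Finset.sum_add_distrib, Bc, ← Complex.ofReal_sum, htrace]
  have hu'u := hu'.trans hu.symm
  have hDu'u := hDu'.trans hDu.symm
  have hBc := h.sum_bilin_symm_eq_zero h' hu'u hDu'u (hDDu'.trans (by rw [hDDu]))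
    (had.laplacian_target_congr h h' hu'u hDu'u hΔu hL) (hN.trans (by rw [hu, hDu]))
  simpa [Bc, ← Complex.ofReal_sum] using hBc

theorem exists_pos_sum_totalJacobian_eq [NeZero n] (had : φ.IsAdmissible L L') (hz : z ∈ φ.dom)
    {p : Indep n →L[ℝ] ℂ} (hdet : (φ.totalJacobian z p).det ≠ 0) :
    ∃ c : ℝ, 0 < c ∧ ∀ f g : Indep n →L[ℝ] ℝ,
      ∑ a, f (φ.totalJacobian z p (axisX a)) * g (φ.totalJacobian z p (axisX a))
        = c * ∑ a, f (axisX a) * g (axisX a) :=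
  let N := (φ.totalJacobian z p).toContinuousLinearEquivOfDetNeZero hdet
  exists_pos_sum_mul_eq_mul_sum N (f₀ := formX 0) (a₀ := 0) (by simp [formX_axisX])
    fun _ hB htrace => had.sum_bilin_symm_eq_zero hz
      (ContinuousLinearMap.coe_toContinuousLinearEquivOfDetNeZero _ hdet) hB htrace

/- The quadratic forms `∑ a, f(D_a Y) g(D_a Y)` at `p` and `p ± s dx_0 ⊗ w` are multiples of one
form of rank `n`, whereas their second difference in `s` is `2 f(ξ) g(ξ)` with `ξ = ∂_w Y`. -/
theorem isFibrePreserving (hn : 2 ≤ n) (had : φ.IsAdmissible L L') : φ.IsFibrePreserving := by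
  intro z hz w
  have : NeZero n := ⟨by omega⟩
  have : Nontrivial (Fin n) := Fin.nontrivial_iff_two_le.2 hn
  obtain ⟨p, hp⟩ := exists_totalJacobian_det_ne_zero hz
  let δ : Indep n →L[ℝ] ℂ := (formX 0).smulRight w
  obtain ⟨s, hs₀, hs, hs'⟩ := exists_ne_zero_totalJacobian_add_smul_det_ne_zero hp δ
  obtain ⟨c, -, hc⟩ := had.exists_pos_sum_totalJacobian_eq hz hp
  obtain ⟨c₁, -, hc₁⟩ := had.exists_pos_sum_totalJacobian_eq hz hs
  obtain ⟨c₂, -, hc₂⟩ := had.exists_pos_sum_totalJacobian_eq hz hs'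
  refine eq_zero_of_forall_mul_eq_mul_sum formX_axisX (κ := (c₁ + c₂ - 2 * c) / (2 * s ^ 2))
    fun f g => ?_
  let ξ : Indep n := fderiv ℝ φ.base z (0, 0, w)
  have hJ (r : ℝ) (a : Fin n) : φ.totalJacobian z (p + r • δ) (axisX a)
      = φ.totalJacobian z p (axisX a) + (r * formX 0 (axisX a)) • ξ := by
    rw [totalJacobian_add]
    simp [δ, ξ, mul_smul, ← map_smul]
  have hsum := congrArg₂ (· + ·) (hc₁ f g) (hc₂ f g)
  simp only [hJ, map_add, map_smul, smul_eq_mul, ← Finset.sum_add_distrib] at hsum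
  have hδ : ∑ a : Fin n, formX 0 (axisX a) ^ 2 = 1 := by simp [formX_axisX]
  have hdiff : 2 * ∑ a, f (φ.totalJacobian z p (axisX a)) * g (φ.totalJacobian z p (axisX a))
      + 2 * s ^ 2 * (f ξ * g ξ) * ∑ a : Fin n, formX 0 (axisX a) ^ 2
      = (c₁ + c₂) * ∑ a, f (axisX a) * g (axisX a) := by
    rw [add_mul, ← hsum, Finset.mul_sum, Finset.mul_sum, ← Finset.sum_add_distrib]
    exact Finset.sum_congr rfl fun a _ => by ring
  rw [hc f g, hδ] at hdiff
  field_simp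
  linear_combination hdiff

theorem exists_pos_sum_fderiv_base_eq (hn : 2 ≤ n) (had : φ.IsAdmissible L L')
    (hz : z ∈ φ.dom) :
    ∃ c : ℝ, 0 < c ∧ ∀ f g : Indep n →L[ℝ] ℝ,
      ∑ a, f (fderiv ℝ φ.base z (varsAxisX a)) * g (fderiv ℝ φ.base z (varsAxisX a))
        = c * ∑ a, f (axisX a) * g (axisX a) :=
  have : NeZero n := ⟨by omega⟩
  had.exists_pos_sum_totalJacobian_eq hz
    ((had.isFibrePreserving hn).totalJacobian_det_ne_zero hz 0)

theorem vdX_T_eq_zero (hn : 2 ≤ n) (had : φ.IsAdmissible L L') (hz : z ∈ φ.dom) (a : Fin n) :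
    vdX a φ.T z = 0 := by
  obtain ⟨c, -, hc⟩ := had.exists_pos_sum_fderiv_base_eq hn hz
  have hsq : ∑ a, vdX a φ.T z * vdX a φ.T z = 0 := by
    have hfst := hc (.fst ℝ ℝ (Fin n → ℝ)) (.fst ℝ ℝ (Fin n → ℝ))
    simpa [fderiv_base hz, axisX, vdX, varsAxisX] using hfst
  exact mul_self_eq_zero.1
    ((Finset.sum_eq_zero_iff_of_nonneg fun a _ => mul_self_nonneg _).1 hsq a (Finset.mem_univ a))

theorem exists_pos_sum_vdX_X_eq (hn : 2 ≤ n) (had : φ.IsAdmissible L L') (hz : z ∈ φ.dom) :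
    ∃ c : ℝ, 0 < c ∧ ∀ i j,
      ∑ a, vdX a (φ.X · i) z * vdX a (φ.X · j) z = if i = j then c else 0 := by
  obtain ⟨c, hpos, hc⟩ := had.exists_pos_sum_fderiv_base_eq hn hz
  simp only [fderiv_base hz] at hc
  refine ⟨c, hpos, fun i j => ?_⟩
  simp only [vdX, fderiv_X_apply hz]
  exact (hc (formX i) (formX j)).trans (by simp [formX_axisX])

theorem vdT_T_ne_zero (hn : 2 ≤ n) (had : φ.IsAdmissible L L') (hz : z ∈ φ.dom) :
    vdT φ.T z ≠ 0 := by
  intro hT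
  obtain ⟨a, ha⟩ := surjective_fderiv_base hz (1, 0)
  have hsplit : a = a.1 • ((1, 0, 0) : Vars n) + ∑ b, a.2.1 b • varsAxisX b + (0, 0, a.2.2) := by
    ext
    · simp [Prod.fst_sum, varsAxisX]
    · simp [Prod.fst_sum, Prod.snd_sum, varsAxisX, Finset.sum_apply, Pi.single_apply]
    · simp [Prod.snd_sum, varsAxisX]
  have hTψ : fderiv ℝ φ.T z (0, 0, a.2.2) = 0 := by
    have hbase := had.isFibrePreserving hn z hz a.2.2
    rw [fderiv_base hz] at hbase
    exact congrArg Prod.fst hbase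
  have hTx (b : Fin n) : fderiv ℝ φ.T z (varsAxisX b) = 0 := had.vdX_T_eq_zero hn hz b
  have hTa : fderiv ℝ φ.T z a = 0 := by
    rw [vdT] at hT
    rw [hsplit, map_add, map_add, map_sum, hTψ, map_smul, hT]
    simp [hTx]
  rw [fderiv_base hz, hTa] at ha
  exact zero_ne_one (congrArg Prod.fst ha)

theorem exists_isConformalWith (hn : 2 ≤ n) (had : φ.IsAdmissible L L')
    (hfib : ∀ (t : ℝ) (x : Fin n → ℝ), IsPreconnected {w : ℂ | (t, x, w) ∈ φ.dom}) :
    ∃ H, φ.IsConformalWith H := by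
  let i : Fin n := ⟨0, by omega⟩
  have hfibre := had.isFibrePreserving hn
  obtain ⟨D, hD, hXD⟩ : ∃ D : Indep n → Vars n →L[ℝ] ℝ, ContDiffOn ℝ ∞ D φ.indepDom ∧
      ∀ z ∈ φ.dom, fderiv ℝ (φ.X · i) z = D (z.1, z.2.1) := by
    refine exists_contDiffOn_eq_of_fderiv_fibre_eq_zero φ.isOpen_dom hfib (by simp)
      ((contDiffOn_pi.1 φ.smooth_X i).fderiv_of_isOpen φ.isOpen_dom (by simp)) fun z hz w => ?_
    refine ContinuousLinearMap.ext fun c => ?_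
    have hbase := hfibre.fderiv_fderiv_base_fibre hz c w
    rw [fderiv_fderiv_base hz, Prod.mk_eq_zero] at hbase
    rw [fderiv_fderiv_comm ((contDiffAt_X_apply hz i).of_le two_le_infty)]
    exact congrFun hbase.2 i
  let H (q : Indep n) : ℝ := ∑ a, D q (varsAxisX a) * D q (varsAxisX a)
  have hconf : ∀ z ∈ φ.dom, 0 < H (z.1, z.2.1) ∧ ∀ b c,
      ∑ a, vdX a (φ.X · b) z * vdX a (φ.X · c) z = if b = c then H (z.1, z.2.1) else 0 := by
    intro z hz
    obtain ⟨c, hpos, hc⟩ := had.exists_pos_sum_vdX_X_eq hn hz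
    have hH : H (z.1, z.2.1) = c := by
      simp only [H, ← hXD z hz]
      exact (hc i i).trans (if_pos rfl)
    rw [hH]
    exact ⟨hpos, hc⟩
  have hψ := isFibrePreserving_iff.1 hfibre
  refine ⟨H, ⟨?_, ?_, fun z hz => (hψ z hz).1.1, fun z hz => (hψ z hz).1.2,
    fun z hz => had.vdX_T_eq_zero hn hz, fun z hz => had.vdT_T_ne_zero hn hz,
    fun z hz a => ((hψ z hz).2 a).1, fun z hz a => ((hψ z hz).2 a).2,
    fun z hz => (hconf z hz).2⟩⟩
  · exact ContDiffOn.sum fun a _ =>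
      (hD.clm_apply contDiffOn_const).mul (hD.clm_apply contDiffOn_const)
  · rintro _ ⟨z, hz, rfl⟩
    exact (hconf z hz).1

end IsAdmissible

end PointTransformation

theorem forall_affine_eq_zero_iff {α β G F γ R : ℂ}
    (hinj : ∀ w, α * w - β * conj w = 0 → w = 0) :
    (∀ τ σ : ℂ, Complex.I * τ + G * σ + F = 0 ↔
      α * (Complex.I * τ + γ * σ + F) - β * conj (Complex.I * τ - conj γ * σ + F) + R = 0) ↔
    α * (γ - G) = 0 ∧ β * (γ + conj G) = 0 ∧ R = 0 := by
  have hsplit (τ σ : ℂ) :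
      α * (Complex.I * τ + γ * σ + F) - β * conj (Complex.I * τ - conj γ * σ + F) + R
        = α * (Complex.I * τ + G * σ + F) - β * conj (Complex.I * τ + G * σ + F)
          + (α * (γ - G) * σ + β * (γ + conj G) * conj σ + R) := by
    simp only [map_add, map_sub, map_mul, Complex.conj_conj]
    ring
  simp only [hsplit]
  constructor
  · intro h
    have hzero (σ : ℂ) : α * (γ - G) * σ + β * (γ + conj G) * conj σ + R = 0 := by
      have hsol : Complex.I * (Complex.I * (G * σ + F)) + G * σ + F = 0 := by
        linear_combination (G * σ + F) * Complex.I_mul_I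
      simpa [hsol] using (h _ σ).1 hsol
    have hR : R = 0 := by simpa using hzero 0
    have hone := hzero 1
    have hI := hzero Complex.I
    rw [map_one] at hone
    rw [Complex.conj_I] at hI
    have hα : α * (γ - G) = 0 := by
      linear_combination hone / 2 - Complex.I / 2 * hI + (Complex.I - 1) / 2 * hR
        + (α * (γ - G) - β * (γ + conj G)) / 2 * Complex.I_mul_I
    exact ⟨hα, by linear_combination hone - hα - hR, hR⟩
  · rintro ⟨hα, hβ, hR⟩ τ σ
    simp only [hα, hβ, hR, zero_mul, add_zero]
    exact ⟨fun h => by simp [h], hinj _⟩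

theorem exists_clm_time_eq_axisX_eq {n : ℕ} (τ : ℂ) (p : Fin n → ℂ) :
    ∃ P : Indep n →L[ℝ] ℂ, P (1, 0) = τ ∧ ∀ a, P (axisX a) = p a :=
  ⟨(ContinuousLinearMap.fst ℝ ℝ (Fin n → ℝ)).smulRight τ + ∑ a, (formX a).smulRight (p a),
    by simp [formX], fun a => by simp [formX, axisX, Pi.single_apply]⟩

namespace PointTransformation

variable {n : ℕ} {φ : PointTransformation n} {H : Indep n → ℝ} {L : ClassN n φ.dom}
  {L' : ClassN n φ.image}

theorem IsFibrePreserving.exists_carriesAt [NeZero n] (h : φ.IsFibrePreserving) {y : GradVars n}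
    (hy : y.1 ∈ φ.dom) (τ σ : ℂ) :
    ∃ u q v, φ.CarriesAt u q v ∧ gradJet u q = y ∧ pdT u q = τ ∧
      ∑ a, pdX a (pdX a u) q = σ := by
  obtain ⟨p, hpT, hpX⟩ := exists_clm_time_eq_axisX_eq τ y.2
  obtain ⟨B, hB, htrace⟩ := exists_symm_bilin_trace_eq (n := n) σ
  obtain ⟨u, v, hcar, hu, hDu, hDDu⟩ :=
    exists_carriesAt_of_jet hy (h.totalJacobian_det_ne_zero hy p) hB
  refine ⟨u, _, v, hcar, Prod.ext hu (funext fun a => ?_), ?_, ?_⟩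
  · exact (congrArg (· (axisX a)) hDu).trans (hpX a)
  · rw [pdT, hDu, hpT]
  · rw [sum_pdX_pdX (hcar.smooth_source.of_le two_le_infty), hDDu, htrace]

variable (φ H) in
/-- The coefficient `T_t G̃ / H` with which `ψ_aa` enters the pullback of `L'` by `φ`. -/
noncomputable def pullbackG (L' : ClassN n φ.image) (y : GradVars n) : ℂ :=
  ((vdT φ.T y.1 / H (y.1.1, y.1.2.1) : ℝ) : ℂ) * L'.G (φ.newGradVars H y.1 y.2)

variable (φ H) in
/-- `T_t` times the left-hand side of `L'`, pulled back by `φ` and written as a function of the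
first-order jet `y` and of `τ = ψ_t`, `σ = ψ_aa`. The term `F` of `L` is added and subtracted
(inside `φ.newF`) so that the comparison with `L` can be read off. -/
noncomputable def pullbackLhs (L : ClassN n φ.dom) (L' : ClassN n φ.image) (y : GradVars n)
    (τ σ : ℂ) : ℂ :=
  vdPsi φ.Ψ y.1 * (Complex.I * τ + φ.pullbackG H L' y * σ + L.F y)
    - vdPsiBar φ.Ψ y.1 * conj (Complex.I * τ - conj (φ.pullbackG H L' y) * σ + L.F y)
    + ((vdT φ.T y.1 : ℝ) : ℂ) * (L'.F (φ.newGradVars H y.1 y.2)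
      - φ.newF H L.F (L'.G (φ.newGradVars H y.1 y.2)) y.1 y.2)

theorem CarriesAt.holdsAt_target_iff {u v : Indep n → ℂ} {q : Indep n} (h : φ.CarriesAt u q v)
    (hc : φ.IsConformalWith H) :
    L'.HoldsAt v (φ.newIndep u q) ↔
      φ.pullbackLhs H L L' (gradJet u q) (pdT u q) (∑ a, pdX a (pdX a u) q) = 0 := by
  have hT : ((vdT φ.T (graphMap u q) : ℝ) : ℂ) ≠ 0 :=
    Complex.ofReal_ne_zero.2 (hc.T_t _ h.mem_dom)
  rw [ClassN.HoldsAt, h.gradJet_target hc, ← mul_eq_zero_iff_left hT,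
    h.transformed_equation hc L.F]
  rfl

namespace IsConformalWith

theorem isAdmissible_iff_forall_pullbackLhs [NeZero n] (h : φ.IsConformalWith H) :
    φ.IsAdmissible L L' ↔ ∀ z ∈ φ.dom, ∀ p τ σ,
      (Complex.I * τ + L.G (z, p) * σ + L.F (z, p) = 0 ↔
        φ.pullbackLhs H L L' (z, p) τ σ = 0) := by
  constructor
  · intro had z hz p τ σ
    obtain ⟨u, q, v, hcar, hjet, rfl, rfl⟩ :=
      h.isFibrePreserving.exists_carriesAt (y := (z, p)) hz τ σ
    rw [← hjet]
    exact (had u q v hcar).trans (hcar.holdsAt_target_iff h)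
  · intro hiff u q v hcar
    exact (hiff _ hcar.mem_dom _ _ _).trans (hcar.holdsAt_target_iff h).symm

theorem pullbackG_eq_iff (h : φ.IsConformalWith H) {y : GradVars n} (hy : y.1 ∈ φ.dom) {w : ℂ} :
    φ.pullbackG H L' y = w ↔ L'.G (φ.newGradVars H y.1 y.2)
      = ((H (y.1.1, y.1.2.1) / vdT φ.T y.1 : ℝ) : ℂ) * w := by
  have hratio : ((vdT φ.T y.1 / H (y.1.1, y.1.2.1) : ℝ) : ℂ) ≠ 0 :=
    Complex.ofReal_ne_zero.2 (div_ne_zero (h.T_t _ hy) (h.H_ne_zero hy))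
  rw [pullbackG, ← eq_inv_mul_iff_mul_eq₀ hratio, ← Complex.ofReal_inv, inv_div]

theorem isAdmissible_iff [NeZero n] (h : φ.IsConformalWith H) :
    φ.IsAdmissible L L' ↔ ∀ z ∈ φ.dom, ∀ p : Fin n → ℂ,
      (conj (L.G (z, p)) ≠ -L.G (z, p) → vdPsi φ.Ψ z * vdPsiBar φ.Ψ z = 0) ∧
      (vdPsi φ.Ψ z ≠ 0 → L'.G (φ.newGradVars H z p)
        = ((H (z.1, z.2.1) / vdT φ.T z : ℝ) : ℂ) * L.G (z, p)) ∧
      (vdPsiBar φ.Ψ z ≠ 0 → L'.G (φ.newGradVars H z p)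
        = ((H (z.1, z.2.1) / vdT φ.T z : ℝ) : ℂ) * -conj (L.G (z, p))) ∧
      L'.F (φ.newGradVars H z p) = φ.newF H L.F (L'.G (φ.newGradVars H z p)) z p := by
  have hT {z : Vars n} (hz : z ∈ φ.dom) : ((vdT φ.T z : ℝ) : ℂ) ≠ 0 :=
    Complex.ofReal_ne_zero.2 (h.T_t z hz)
  rw [h.isAdmissible_iff_forall_pullbackLhs]
  refine forall₂_congr fun z hz => forall_congr' fun p => ?_
  simp only [pullbackLhs]
  rw [forall_affine_eq_zero_iff fun _ => h.eq_zero_of_wirtinger hz, mul_eq_zero, mul_eq_zero,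
    mul_eq_zero_iff_left (hT hz), sub_eq_zero, sub_eq_zero, ← eq_neg_iff_add_eq_zero,
    or_iff_not_imp_left, or_iff_not_imp_left, h.pullbackG_eq_iff hz, h.pullbackG_eq_iff hz]
  refine ⟨fun hconditions => ⟨fun hG => ?_, hconditions⟩, And.right⟩
  by_contra hΨ
  rw [mul_eq_zero, not_or] at hΨ
  have hG₁ := (h.pullbackG_eq_iff hz).2 (hconditions.1 hΨ.1)
  have hG₂ := (h.pullbackG_eq_iff hz).2 (hconditions.2.1 hΨ.2)
  exact hG (neg_eq_iff_eq_neg.1 (hG₂.symm.trans hG₁))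

end IsConformalWith

end PointTransformation

theorem mainTheorem1 (n : ℕ) (hn : 2 ≤ n) (φ : PointTransformation n)
    (hfib : ∀ (t : ℝ) (x : Fin n → ℝ), IsPreconnected {w : ℂ | (t, x, w) ∈ φ.dom})
    (L : ClassN n φ.dom) (L' : ClassN n φ.image) :
    φ.IsAdmissible L L' ↔
      ∃ H : Indep n → ℝ, φ.IsConformalWith H ∧
        ∀ z ∈ φ.dom, ∀ p : Fin n → ℂ,
          (conj (L.G (z, p)) ≠ -L.G (z, p) → vdPsi φ.Ψ z * vdPsiBar φ.Ψ z = 0) ∧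
          (vdPsi φ.Ψ z ≠ 0 →
            L'.G (φ.newGradVars H z p)
              = ((H (z.1, z.2.1) / vdT φ.T z : ℝ) : ℂ) * L.G (z, p)) ∧
          (vdPsiBar φ.Ψ z ≠ 0 →
            L'.G (φ.newGradVars H z p)
              = ((H (z.1, z.2.1) / vdT φ.T z : ℝ) : ℂ) * -conj (L.G (z, p))) ∧
          L'.F (φ.newGradVars H z p)
            = φ.newF H L.F (L'.G (φ.newGradVars H z p)) z p := by
  have : NeZero n := ⟨by omega⟩
  constructor
  · intro had
    obtain ⟨H, hH⟩ := had.exists_isConformalWith hn hfib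
    exact ⟨H, hH, hH.isAdmissible_iff.1 had⟩
  · rintro ⟨H, hH, hconditions⟩
    exact hH.isAdmissible_iff.2 hconditions
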